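/- Let $p>2$ be a prime and write $\mathbb{E}_{x\in X}$ for $\frac1{|X|}\sum_{x\in X}$. A quadratic factor $\mathcal{B}=(\mathcal{L},\mathcal{Q})$ on $\mathbb{F}_p^n$ of complexity $(\ell,q)$ consists of linearly independent vectors $r_1,\dots,r_\ell\in\mathbb{F}_p^n$ and symmetric $n\times n$ matrices $M_1,\dots,M_q$ over $\mathbb{F}_p$. Its rank is the minimum of $\mathrm{rk}(\lambda_1M_1+\dots+\lambda_qM_q)$ over $\lambda\in\mathbb{F}_p^q\setminus\{0\}$ (it is $\infty$ if $q=0$). For $a=(a',a'')\in\mathbb{F}_p^{\ell}\times\mathbb{F}_p^{q}$ and $b\in\mathbb{F}_p^q$ put $$B(a)=\{x: x^Tr_i=a'_i\ (i\le \ell),\ x^TM_jx=a''_j\ (j\le q)\},\qquad \beta(b)=\{(x,y): x^TM_jy=b_j\ (j\le q)\},$$ and $\mu_{\beta}(x,y)=1_{\beta}(x,y)\,p^{2n}/|\beta|$. For a tuple $d=(a_1,a_2,a_3,b_{12},b_{13},b_{23})\in(\mathbb{F}_p^{\ell+q})^3\times(\mathbb{F}_p^q)^3$ let $\Sigma(d)=a_1+a_2+a_3+2(0,b_{12})+2(0,b_{13})+2(0,b_{23})$.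 For $f:\mathbb{F}_p^n\to\mathbb{C}$ define $\|f\|_{U^3(d)}\ge 0$ by $$\|f\|_{U^3(d)}^8=\mathbb{E}_{x_0,x_1\in B(a_1)}\mathbb{E}_{y_0,y_1\in B(a_2)}\mathbb{E}_{z_0,z_1\in B(a_3)}\prod_{i,j}\mu_{\beta(b_{12})}(x_i,y_j)\prod_{i,k}\mu_{\beta(b_{13})}(x_i,z_k)\prod_{j,k}\mu_{\beta(b_{23})}(y_j,z_k)\prod_{\omega\in\{0,1\}^3}\mathcal{C}^{|\omega|}f(x_{\omega(1)}+y_{\omega(2)}+z_{\omega(3)}),$$ where $i,j,k$ range over $\{0,1\}$, $\mathcal{C}$ is complex conjugation and $|\omega|=\omega(1)+\omega(2)+\omega(3)$. A growth function is an increasing function $\mathbb{R}^+\to\mathbb{R}^+$, and inequalities between growth functions are pointwise. **Proposition (counting lemma for induced ternary sums across quadratic atoms).** For every positive integer $m$ there is a constant $C=C(m)>0$ such that for all $\varepsilon>0$ there is a growth function $\tau_0=\tau_0(m,\varepsilon)$ such that the following holds for every growth function $\tau\ge\tau_0$ and every prime $p>2$. Let $U,V,W\subseteq[m]$ and let $F$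 be a $3$-partite $3$-uniform hypergraph with vertex classes (disjoint copies of) $U,V,W$ and edge set $E_F$. Let $\mathcal{B}$ be a quadratic factor on $\mathbb{F}_p^n$ of complexity $(\ell,q)$ and rank at least $\tau(\ell+q)$, and let $A\subseteq\mathbb{F}_p^n$, with complement $A^C$. Let $a_u,b_v,c_w\in\mathbb{F}_p^{\ell+q}$ and $d_{uv},d_{uw},d_{vw}\in\mathbb{F}_p^q$ be labels for $u\in U$, $v\in V$, $w\in W$, let $e_{uvw}=(a_u,b_v,c_w,d_{uv},d_{uw},d_{vw})$ and $e=(e_{uvw})$, and let $\alpha_{uvw}=|A\cap B(\Sigma(e_{uvw}))|/|B(\Sigma(e_{uvw}))|$. Suppose that $\|1_A-\alpha_{uvw}\|_{U^3(e_{uvw})}\le\varepsilon$ for all $(u,v,w)\in U\times V\times W$. Put $$P=\prod_{uvw\in E_F}\alpha_{uvw}\prod_{uvw\notin E_F}(1-\alpha_{uvw}),$$ and $$T=\mathbb{E}_{x_u\in B(a_u):u\in U}\ \mathbb{E}_{y_v\in B(b_v):v\in V}\ \mathbb{E}_{z_w\in B(c_w):w\in W}\ \prod_{u,v}\mu_{\beta(d_{uv})}(x_u,y_v)\prod_{u,w}\mu_{\beta(d_{uw})}(x_u,z_w)\prod_{v,w}\mu_{\beta(d_{vw})}(y_v,z_w)\prod_{u,v,w}f_{uvw}(x_u+y_v+z_w),$$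 where $f_{uvw}=1_A$ if $uvw\in E_F$ and $f_{uvw}=1_{A^C}$ if $uvw\notin E_F$. Then $$|T-P|<3\varepsilon m^3.$$ Moreover, let $\mathcal{I}_F(e)$ be the set of tuples $((x_u)_{u\in U},(y_v)_{v\in V},(z_w)_{w\in W})$ in $\prod_uB(a_u)\times\prod_vB(b_v)\times\prod_wB(c_w)$ such that $(x_u,y_v)\in\beta(d_{uv})$, $(x_u,z_w)\in\beta(d_{uw})$ and $(y_v,z_w)\in\beta(d_{vw})$ for all $(u,v,w)\in U\times V\times W$. Then the number of tuples in $\mathcal{I}_F(e)$ such that, for all $(u,v,w)$, $x_u+y_v+z_w\in A$ if and only if $uvw\in E_F$, differs from $P\,|\mathcal{I}_F(e)|$ by at most $C\varepsilon\,|\mathcal{I}_F(e)|$. -/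

import Mathlib

open Finset
open scoped BigOperators

namespace TernaryCount

/-- The vector space `𝔽_p^n`. -/
abbrev Vec (p n : ℕ) : Type := Fin n → ZMod p

/-- A growth function `ℝ⁺ → ℝ⁺`: increasing and positive on the positive reals
(values outside the positive reals are irrelevant). -/
def IsGrowthFunction (τ : ℝ → ℝ) : Prop :=
  MonotoneOn τ (Set.Ioi 0) ∧ ∀ x, 0 < x → 0 < τ x

/-- A quadratic factor `(𝓛, 𝓠)` on `𝔽_p^n` of complexity `(ℓ, q)`: linearly independent vectors
`r_1, …, r_ℓ` and symmetric matrices `M_1, …, M_q`. -/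
structure QuadraticFactor (p n l q : ℕ) where
  r : Fin l → Vec p n
  linearIndependent : LinearIndependent (ZMod p) r
  M : Fin q → Matrix (Fin n) (Fin n) (ZMod p)
  isSymm : ∀ j, (M j).IsSymm

/-- Labels in `𝔽_p^{ℓ+q} = 𝔽_p^ℓ × 𝔽_p^q` of quadratic atoms. -/
abbrev AtomLabel (p l q : ℕ) : Type := (Fin l → ZMod p) × (Fin q → ZMod p)

/-- A tuple `(a_1, a_2, a_3, b_12, b_13, b_23)` of three atom labels and three labels in `𝔽_p^q`
of bilinear level sets. -/
structure SixLabel (p l q : ℕ) where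
  a₁ : AtomLabel p l q
  a₂ : AtomLabel p l q
  a₃ : AtomLabel p l q
  b₁₂ : Fin q → ZMod p
  b₁₃ : Fin q → ZMod p
  b₂₃ : Fin q → ZMod p

/-- `Σ(d) = a_1 + a_2 + a_3 + 2(0 b_12) + 2(0 b_13) + 2(0 b_23)`, where `0 b` is `b` preceded
by `ℓ` zeros. -/
def SixLabel.sigma {p l q : ℕ} (d : SixLabel p l q) : AtomLabel p l q :=
  d.a₁ + d.a₂ + d.a₃ + (2 : ℕ) • ((0, d.b₁₂) : AtomLabel p l q)
    + (2 : ℕ) • ((0, d.b₁₃) : AtomLabel p l q) + (2 : ℕ) • ((0, d.b₂₃) : AtomLabel p l q)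

namespace QuadraticFactor

/-- The rank of the factor: the minimum of `rk(λ_1 M_1 + … + λ_q M_q)` over `λ ≠ 0`
(it is `⊤` if `q = 0`). -/
noncomputable def rank {p n l q : ℕ} (B : QuadraticFactor p n l q) : EReal :=
  ⨅ (c : Fin q → ZMod p) (_ : c ≠ 0), (((∑ j, c j • B.M j).rank : ℝ) : EReal)

variable {p n l q : ℕ} [Fact p.Prime]

/-- The atom `B(a) = {x : x^T r_i = a_i, x^T M_j x = a'_j}` with label `(a, a')`. -/
def atom (B : QuadraticFactor p n l q) (a : AtomLabel p l q) : Finset (Vec p n) :=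
  univ.filter fun x =>
    (∀ i, dotProduct x (B.r i) = a.1 i) ∧ ∀ j, dotProduct x ((B.M j).mulVec x) = a.2 j

/-- The bilinear level set `β(b) = {(x, y) : x^T M_j y = b_j}`. -/
def beta (B : QuadraticFactor p n l q) (b : Fin q → ZMod p) : Finset (Vec p n × Vec p n) :=
  univ.filter fun z => ∀ j, dotProduct z.1 ((B.M j).mulVec z.2) = b j

/-- The characteristic measure `μ_{β(b)}(x, y) = 1_{β(b)}(x, y) |𝔽_p^n|² / |β(b)|`. -/
noncomputable def mu (B : QuadraticFactor p n l q) (b : Fin q → ZMod p) (x y : Vec p n) : ℝ :=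
  if (x, y) ∈ B.beta b then (Fintype.card (Vec p n) : ℝ) ^ 2 / ((B.beta b).card : ℝ) else 0

/-- The density of `A` on the atom `B(a)`. -/
noncomputable def density (B : QuadraticFactor p n l q) (A : Finset (Vec p n))
    (a : AtomLabel p l q) : ℝ :=
  ((A ∩ B.atom a).card : ℝ) / ((B.atom a).card : ℝ)

/-- The local `U³` inner product of `(f_ω)_{ω ∈ {0,1}³}` with respect to the tuple `d`. -/
noncomputable def localU3Inner (B : QuadraticFactor p n l q) (d : SixLabel p l q)
    (f : Fin 2 × Fin 2 × Fin 2 → Vec p n → ℂ) : ℂ :=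
  𝔼 x ∈ Fintype.piFinset fun _ : Fin 2 => B.atom d.a₁,
  𝔼 y ∈ Fintype.piFinset fun _ : Fin 2 => B.atom d.a₂,
  𝔼 z ∈ Fintype.piFinset fun _ : Fin 2 => B.atom d.a₃,
    (∏ i, ∏ j, (B.mu d.b₁₂ (x i) (y j) : ℂ)) *
    (∏ i, ∏ k, (B.mu d.b₁₃ (x i) (z k) : ℂ)) *
    (∏ j, ∏ k, (B.mu d.b₂₃ (y j) (z k) : ℂ)) *
    ∏ ω : Fin 2 × Fin 2 × Fin 2,
      (starRingEnd ℂ)^[(ω.1 : ℕ) + (ω.2.1 : ℕ) + (ω.2.2 : ℕ)]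
        (f ω (x ω.1 + y ω.2.1 + z ω.2.2))

/-- The local `U³` semi-norm `‖f‖_{U³(d)}`, the eighth root of the inner product of eight copies
of `f`, which is a nonnegative real number (see `localU3Inner_self_nonneg`). -/
noncomputable def localU3Norm (B : QuadraticFactor p n l q) (d : SixLabel p l q)
    (f : Vec p n → ℂ) : ℝ :=
  (B.localU3Inner d fun _ => f).re ^ (1 / 8 : ℝ)

theorem mu_nonneg (B : QuadraticFactor p n l q) (b : Fin q → ZMod p) (x y : Vec p n) :
    0 ≤ B.mu b x y := by
  unfold mu; split_ifs <;> positivity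

open ComplexOrder in
theorem localU3Inner_self_nonneg (B : QuadraticFactor p n l q) (d : SixLabel p l q)
    (f : Vec p n → ℂ) : 0 ≤ B.localU3Inner d fun _ => f := by
  unfold localU3Inner
  refine Finset.expect_nonneg fun x _ => Finset.expect_nonneg fun y _ => ?_
  let P : Vec p n → ℂ := fun z =>
    ((∏ i, (B.mu d.b₁₃ (x i) z : ℂ)) * ∏ j, (B.mu d.b₂₃ (y j) z : ℂ)) *
      ∏ i : Fin 2, ∏ j : Fin 2, (starRingEnd ℂ)^[(i : ℕ) + (j : ℕ)] (f (x i + y j + z))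
  let g : Fin 2 → Vec p n → ℂ := fun k z => (starRingEnd ℂ)^[(k : ℕ)] (P z)
  have key : ∀ z : Fin 2 → Vec p n,
      (∏ i, ∏ j, (B.mu d.b₁₂ (x i) (y j) : ℂ)) *
      (∏ i, ∏ k, (B.mu d.b₁₃ (x i) (z k) : ℂ)) *
      (∏ j, ∏ k, (B.mu d.b₂₃ (y j) (z k) : ℂ)) *
      ∏ ω : Fin 2 × Fin 2 × Fin 2,
        (starRingEnd ℂ)^[(ω.1 : ℕ) + (ω.2.1 : ℕ) + (ω.2.2 : ℕ)]
          (f (x ω.1 + y ω.2.1 + z ω.2.2))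
      = (∏ i, ∏ j, (B.mu d.b₁₂ (x i) (y j) : ℂ)) * ∏ k, g k (z k) := by
    intro z
    simp only [g, P, Fintype.prod_prod_type, Fin.prod_univ_two, Fin.val_zero, Fin.val_one,
      Function.iterate_succ, Function.iterate_zero, Function.comp, id, map_mul,
      Complex.conj_conj, Complex.conj_ofReal, add_zero]
    ring
  rw [Finset.expect, Finset.sum_congr rfl fun z _ => key z, ← Finset.mul_sum,
    ← Finset.prod_univ_sum, Fin.prod_univ_two fun k => ∑ z ∈ B.atom d.a₃, g k z]
  have hg : ∑ z ∈ B.atom d.a₃, g 1 z = (starRingEnd ℂ) (∑ z ∈ B.atom d.a₃, g 0 z) := by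
    simp [g, map_sum]
  have hmu : (0 : ℂ) ≤ ∏ i, ∏ j, (B.mu d.b₁₂ (x i) (y j) : ℂ) :=
    Finset.prod_nonneg fun i _ => Finset.prod_nonneg fun j _ => by
      exact_mod_cast B.mu_nonneg _ _ _
  rw [hg, Complex.mul_conj]
  exact smul_nonneg (by positivity) (mul_nonneg hmu (by exact_mod_cast Complex.normSq_nonneg _))

end QuadraticFactor

/-- A 3-partite 3-uniform hypergraph with (pairwise disjoint) vertex classes `U`, `V`, `W`: every
edge consists of one vertex from each class. -/
structure TripartiteHypergraph (U V W : Type*) where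
  edges : Set (Set (U ⊕ V ⊕ W))
  tripartite : ∀ s ∈ edges, ∃ u v w, s = {Sum.inl u, Sum.inr (Sum.inl v), Sum.inr (Sum.inr w)}

/-- `uvw` is an edge. -/
def TripartiteHypergraph.IsEdge {U V W : Type*} (F : TripartiteHypergraph U V W)
    (u : U) (v : V) (w : W) : Prop :=
  {Sum.inl u, Sum.inr (Sum.inl v), Sum.inr (Sum.inr w)} ∈ F.edges

/-- A family `e = (e_{uvw})` of label tuples
`e_{uvw} = (a_u, b_v, c_w, d_{uv}, d_{uw}, d_{vw})`. -/
structure LabelFamily (p l q : ℕ) (U V W : Type*) where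
  a : U → AtomLabel p l q
  b : V → AtomLabel p l q
  c : W → AtomLabel p l q
  dUV : U → V → Fin q → ZMod p
  dUW : U → W → Fin q → ZMod p
  dVW : V → W → Fin q → ZMod p

/-- The tuple `e_{uvw}`. -/
def LabelFamily.tuple {p l q : ℕ} {U V W : Type*} (e : LabelFamily p l q U V W)
    (u : U) (v : V) (w : W) : SixLabel p l q :=
  ⟨e.a u, e.b v, e.c w, e.dUV u v, e.dUW u w, e.dVW v w⟩

section Operators

variable {p n l q : ℕ} [Fact p.Prime] {U V W : Type*} [Fintype U] [Fintype V] [Fintype W]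
  [DecidableEq U] [DecidableEq V] [DecidableEq W]

/-- The ternary multi-local operator `T_{F(e)}((f_{u,v,w}))`. -/
noncomputable def ternaryOp (B : QuadraticFactor p n l q) (e : LabelFamily p l q U V W)
    (f : U → V → W → Vec p n → ℂ) : ℂ :=
  𝔼 x ∈ Fintype.piFinset fun u => B.atom (e.a u),
  𝔼 y ∈ Fintype.piFinset fun v => B.atom (e.b v),
  𝔼 z ∈ Fintype.piFinset fun w => B.atom (e.c w),
    (∏ u, ∏ v, (B.mu (e.dUV u v) (x u) (y v) : ℂ)) *
    (∏ u, ∏ w, (B.mu (e.dUW u w) (x u) (z w) : ℂ)) *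
    (∏ v, ∏ w, (B.mu (e.dVW v w) (y v) (z w) : ℂ)) *
    ∏ u, ∏ v, ∏ w, f u v w (x u + y v + z w)

open Classical in
/-- `T_{F(e)}(f | g)`: the input function is `f` on edges of `F` and `g` on non-edges. -/
noncomputable def ternaryOpPair (F : TripartiteHypergraph U V W) (B : QuadraticFactor p n l q)
    (e : LabelFamily p l q U V W) (f g : Vec p n → ℂ) : ℂ :=
  ternaryOp B e fun u v w => if F.IsEdge u v w then f else g

open Classical in
/-- `∏_{uvw ∈ E} α_{uvw} ∏_{uvw ∉ E} (1 - α_{uvw})`. -/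
noncomputable def edgeProduct (F : TripartiteHypergraph U V W) (α : U → V → W → ℝ) : ℝ :=
  (∏ t : U × V × W with F.IsEdge t.1 t.2.1 t.2.2, α t.1 t.2.1 t.2.2) *
    ∏ t : U × V × W with ¬ F.IsEdge t.1 t.2.1 t.2.2, (1 - α t.1 t.2.1 t.2.2)

/-- The set `𝓘_F(e)` of tuples `((x_u), (y_v), (z_w))` lying in the atoms and bilinear level sets
prescribed by `e`. -/
def tupleSet (B : QuadraticFactor p n l q) (e : LabelFamily p l q U V W) :
    Set ((U → Vec p n) × (V → Vec p n) × (W → Vec p n)) :=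
  {t | (∀ u, t.1 u ∈ B.atom (e.a u)) ∧ (∀ v, t.2.1 v ∈ B.atom (e.b v)) ∧
    (∀ w, t.2.2 w ∈ B.atom (e.c w)) ∧
    ∀ u v w, (t.1 u, t.2.1 v) ∈ B.beta (e.dUV u v) ∧ (t.1 u, t.2.2 w) ∈ B.beta (e.dUW u w) ∧
      (t.2.1 v, t.2.2 w) ∈ B.beta (e.dVW v w)}

/-- The tuples in `𝓘_F(e)` that induce a copy of `F`:
`x_u + y_v + z_w ∈ A` if and only if `uvw` is an edge. -/
def inducedCopies (F : TripartiteHypergraph U V W) (B : QuadraticFactor p n l q)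
    (e : LabelFamily p l q U V W) (A : Finset (Vec p n)) :
    Set ((U → Vec p n) × (V → Vec p n) × (W → Vec p n)) :=
  {t | t ∈ tupleSet B e ∧ ∀ u v w, t.1 u + t.2.1 v + t.2.2 w ∈ A ↔ F.IsEdge u v w}

end Operators

/-- The indicator function `1_A`. -/
noncomputable def ind {p n : ℕ} (A : Finset (Vec p n)) (x : Vec p n) : ℂ :=
  if x ∈ A then 1 else 0

end TernaryCount

namespace TernaryCount

/-! ### Averages over product sets and the basic Cauchy–Schwarz inequality. -/

section Averages

variable {J X : Type*} [Fintype J] [DecidableEq J]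

/-! The first ingredient is equidistribution. Expand a system of atom and bilinear constraints on
several vectors in additive characters. A nontrivial character is either a nonzero linear phase,
whose sum vanishes by linear independence of the `r i`, or a quadratic phase containing a nontrivial
combination of the `M j`, whose sum Weyl differencing bounds in terms of the rank
(`norm_sum_quadratic_mul_pow_le`). Rank linear in `l + q`, with coefficients depending only on `m`
and `ε`, thus makes the weights `μ_β` jointly quasirandom: any product of boundedly many of them has
average within `δ` of 1 over atoms (`QuadraticFactor.abs_expect_prod_mu_le`).

The second is a generalized von Neumann inequality (`norm_ternaryOp_pow_eight_le`): for 1-bounded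
functions the operator is controlled by the local `U³` norm of any single one of them. Three
Cauchy–Schwarz steps double `w₀`, `v₀` and `u₀`; each discards the functions that do not involve the
vertex being doubled. The weights are unbounded and cannot be discarded this way: those away from
the doubled vertex serve as a measure of mass at most `1 + δ`, the others are doubled too. At the
end all weights outside the six surviving variables are replaced by 1 through one more
Cauchy–Schwarz and quasirandomness (`norm_sq_expect_doubledEdges_sub_le`).

The counting statement follows by telescoping: replacing `1_A` by `α` on edges and `1_{A^C}` by `1 -
α` on non-edges, one triple at a time, costs at most `2ε` per triple. The constants factor out and
leave `P` times the average of the weights, which is nearly 1. For indicator inputs the operator is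
a fixed multiple of a number of tuples in `𝓘_F(e)`; dividing by that multiple gives the statement on
induced copies. -/

theorem expect_piecewise (D : J → Finset X) (A : Finset J) (h : (J → X) → ℂ) :
    𝔼 x ∈ Fintype.piFinset D, 𝔼 t ∈ Fintype.piFinset D, h (A.piecewise t x)
      = 𝔼 x ∈ Fintype.piFinset D, h x := by
  rcases (Fintype.piFinset D).eq_empty_or_nonempty with hD | hD
  · simp [hD]
  calc
    _ = 𝔼 x ∈ Fintype.piFinset D, 𝔼 t ∈ Fintype.piFinset D, h x := by
      rw [← expect_product', ← expect_product']
      -- Exchanging the `A`-coordinates of the two points is an involution of the pairs.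
      refine expect_nbij' (fun z => (A.piecewise z.2 z.1, A.piecewise z.1 z.2))
        (fun z => (A.piecewise z.2 z.1, A.piecewise z.1 z.2)) ?_ ?_ ?_ ?_ ?_
      · rintro ⟨x, t⟩ hz
        simp only [mem_product, Fintype.mem_piFinset] at hz ⊢
        exact ⟨fun j => by by_cases hj : j ∈ A <;> simp [hj, hz.1 j, hz.2 j],
          fun j => by by_cases hj : j ∈ A <;> simp [hj, hz.1 j, hz.2 j]⟩
      · rintro ⟨x, t⟩ hz
        simp only [mem_product, Fintype.mem_piFinset] at hz ⊢
        exact ⟨fun j => by by_cases hj : j ∈ A <;> simp [hj, hz.1 j, hz.2 j],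
          fun j => by by_cases hj : j ∈ A <;> simp [hj, hz.1 j, hz.2 j]⟩
      · rintro ⟨x, t⟩ _
        ext j <;> by_cases hj : j ∈ A <;> simp [hj]
      · rintro ⟨x, t⟩ _
        ext j <;> by_cases hj : j ∈ A <;> simp [hj]
      · simp
    _ = _ := by simp [expect_const hD]

theorem expect_comp_injective {K : Type*} [Fintype K] [DecidableEq K] (D : J → Finset X)
    (hD : ∀ j, (D j).Nonempty) {i : K → J} (hi : Function.Injective i) (h : (K → X) → ℂ) :
    𝔼 x ∈ Fintype.piFinset D, h (x ∘ i) = 𝔼 y ∈ Fintype.piFinset (D ∘ i), h y := by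
  have hJ : (Fintype.piFinset D).Nonempty := Fintype.piFinset_nonempty.2 hD
  have hK : (Fintype.piFinset (D ∘ i)).Nonempty := Fintype.piFinset_nonempty.2 fun k => hD (i k)
  have hext : ∀ (y : K → X) (x : J → X), Function.extend i y x ∘ i = y := fun y x => by
    ext k; simp [hi.extend_apply]
  have hmem : ∀ y ∈ Fintype.piFinset (D ∘ i), ∀ x ∈ Fintype.piFinset D,
      Function.extend i y x ∈ Fintype.piFinset D := by
    intro y hy x hx
    rw [Fintype.mem_piFinset] at hx hy ⊢
    intro j
    by_cases hj : ∃ k, i k = j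
    · obtain ⟨k, rfl⟩ := hj
      rw [hi.extend_apply]
      exact hy k
    · rw [Function.extend_apply' _ _ _ hj]
      exact hx j
  have hcomp : ∀ x ∈ Fintype.piFinset D, x ∘ i ∈ Fintype.piFinset (D ∘ i) := by
    intro x hx
    rw [Fintype.mem_piFinset] at hx ⊢
    exact fun k => hx (i k)
  have hback : ∀ (y : K → X) (x : J → X), Function.extend i (x ∘ i) (Function.extend i y x) = x := by
    intro y x
    ext j
    by_cases hj : ∃ k, i k = j
    · obtain ⟨k, rfl⟩ := hj
      simp [hi.extend_apply]
    · simp [Function.extend_apply' _ _ _ hj]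
  calc
    _ = 𝔼 y ∈ Fintype.piFinset (D ∘ i), 𝔼 x ∈ Fintype.piFinset D, h (x ∘ i) := by
      rw [expect_const hK]
    _ = 𝔼 y ∈ Fintype.piFinset (D ∘ i), 𝔼 x ∈ Fintype.piFinset D, h y := by
      rw [← expect_product', ← expect_product']
      refine expect_nbij' (fun z => (z.2 ∘ i, Function.extend i z.1 z.2))
        (fun z => (z.2 ∘ i, Function.extend i z.1 z.2)) ?_ ?_ ?_ ?_ ?_
      · rintro ⟨y, x⟩ hz
        rw [mem_product] at hz ⊢
        exact ⟨hcomp x hz.2, hmem y hz.1 x hz.2⟩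
      · rintro ⟨y, x⟩ hz
        rw [mem_product] at hz ⊢
        exact ⟨hcomp x hz.2, hmem y hz.1 x hz.2⟩
      · rintro ⟨y, x⟩ _
        exact Prod.ext (hext y x) (hback y x)
      · rintro ⟨y, x⟩ _
        exact Prod.ext (hext y x) (hback y x)
      · simp
    _ = _ := by simp [expect_const hJ]

theorem norm_expect_le {ι : Type*} (s : Finset ι) (f : ι → ℂ) :
    ‖𝔼 x ∈ s, f x‖ ≤ 𝔼 x ∈ s, ‖f x‖ := by
  rw [expect_eq_sum_div_card, expect_eq_sum_div_card, norm_div, Complex.norm_natCast]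
  gcongr
  exact norm_sum_le _ _

theorem norm_sq_expect_mul_le {ι : Type*} (s : Finset ι) (w : ι → ℝ) (hw : ∀ x, 0 ≤ w x)
    (H : ι → ℂ) :
    ‖𝔼 x ∈ s, (w x : ℂ) * H x‖ ^ 2 ≤ (𝔼 x ∈ s, w x) * 𝔼 x ∈ s, w x * ‖H x‖ ^ 2 := by
  have h1 : ‖𝔼 x ∈ s, (w x : ℂ) * H x‖ ≤ 𝔼 x ∈ s, √(w x) * (√(w x) * ‖H x‖) := by
    refine (norm_expect_le _ _).trans (expect_le_expect fun x _ => ?_)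
    rw [norm_mul, Complex.norm_real, Real.norm_of_nonneg (hw x), ← mul_assoc,
      Real.mul_self_sqrt (hw x)]
  refine (pow_le_pow_left₀ (norm_nonneg _) h1 2).trans
    ((expect_mul_sq_le_sq_mul_sq s _ _).trans (le_of_eq ?_))
  congr 1
  · exact expect_congr rfl fun x _ => Real.sq_sqrt (hw x)
  · exact expect_congr rfl fun x _ => by rw [mul_pow, Real.sq_sqrt (hw x)]

theorem ofReal_expect {ι : Type*} (s : Finset ι) (f : ι → ℝ) :
    ((𝔼 x ∈ s, f x : ℝ) : ℂ) = 𝔼 x ∈ s, (f x : ℂ) := by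
  simp [expect_eq_sum_div_card]

open ComplexConjugate in
/-- A Cauchy–Schwarz inequality that doubles the coordinates in `A`, with the coordinates in
`π '' A` playing the role of the copies. -/
theorem norm_sq_expect_le (D : J → Finset X) {π : J → J} (hπ : Function.Involutive π)
    (hD : ∀ j, D (π j) = D j) (A : Finset J)
    (w : (J → X) → ℝ) (hw₀ : ∀ x, 0 ≤ w x) (g G : (J → X) → ℂ) (hg₁ : ∀ x, ‖g x‖ ≤ 1)
    (hw : DependsOn w {j | j ∉ A ∧ π j ∉ A}) (hg : DependsOn g {j | j ∉ A ∧ π j ∉ A})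
    (hG : DependsOn G {j | π j ∉ A}) :
    ‖𝔼 x ∈ Fintype.piFinset D, (w x : ℂ) * (g x * G x)‖ ^ 2 ≤
      (𝔼 x ∈ Fintype.piFinset D, w x) *
        (𝔼 x ∈ Fintype.piFinset D, (w x : ℂ) * (G x * conj (G (A.piecewise (x ∘ π) x)))).re := by
  set Ω := Fintype.piFinset D
  have hwA : ∀ x t, w (A.piecewise t x) = w x := fun x t =>
    hw fun j hj => by simp [hj.1]
  have hgA : ∀ x t, g (A.piecewise t x) = g x := fun x t =>
    hg fun j hj => by simp [hj.1]
  have hmemπ : ∀ j, j ∈ A.image π ↔ π j ∈ A := by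
    intro j
    constructor
    · rintro h
      obtain ⟨k, hk, rfl⟩ := mem_image.1 h
      rwa [hπ k]
    · exact fun h => mem_image.2 ⟨π j, h, hπ j⟩
  -- Resampling the coordinates in `A` changes neither `w` nor `g`, so `G` can be averaged over them
  -- before Cauchy–Schwarz.
  have e1 : 𝔼 x ∈ Ω, (w x : ℂ) * (g x * G x)
      = 𝔼 x ∈ Ω, (w x : ℂ) * (g x * 𝔼 t ∈ Ω, G (A.piecewise t x)) := by
    rw [← expect_piecewise D A]
    refine expect_congr rfl fun x _ => ?_
    rw [mul_expect, mul_expect]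
    refine expect_congr rfl fun t _ => ?_
    rw [hwA, hgA]
  have e2 : ((𝔼 x ∈ Ω, w x * ‖𝔼 t ∈ Ω, G (A.piecewise t x)‖ ^ 2 : ℝ) : ℂ)
      = 𝔼 x ∈ Ω, (w x : ℂ) * (G x * conj (G (A.piecewise (x ∘ π) x))) := by
    have s1 : ((𝔼 x ∈ Ω, w x * ‖𝔼 t ∈ Ω, G (A.piecewise t x)‖ ^ 2 : ℝ) : ℂ)
        = 𝔼 x ∈ Ω, 𝔼 t ∈ Ω, (w (A.piecewise t x) : ℂ) * (G (A.piecewise t x) *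
            𝔼 t' ∈ Ω, conj (G (A.piecewise t' (A.piecewise t x)))) := by
      rw [ofReal_expect]
      refine expect_congr rfl fun x _ => ?_
      have : ∀ t t', A.piecewise t' (A.piecewise t x) = A.piecewise t' x := fun t t' => by
        ext j; by_cases hj : j ∈ A <;> simp [hj]
      simp only [this, hwA]
      rw [← mul_expect, ← expect_mul]
      have hc : (𝔼 t' ∈ Ω, conj (G (A.piecewise t' x)))
          = conj (𝔼 t' ∈ Ω, G (A.piecewise t' x)) := by
        simp [expect_eq_sum_div_card, map_sum]
      rw [hc, Complex.mul_conj, Complex.normSq_eq_norm_sq]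
      push_cast
      rfl
    rw [s1, expect_piecewise D A fun x => (w x : ℂ) * (G x *
            𝔼 t' ∈ Ω, conj (G (A.piecewise t' x)))]
    -- The independent second sample of the `A`-coordinates is stored in the coordinates `π '' A`.
    -- Neither `w` nor `G` depends on these, so resampling them is free.
    rw [← expect_piecewise D (A.image π) fun x =>
      (w x : ℂ) * (G x * conj (G (A.piecewise (x ∘ π) x)))]
    refine expect_congr rfl fun x _ => ?_
    rw [mul_expect, mul_expect]
    refine expect_nbij' (fun t => t ∘ π) (fun t => t ∘ π) ?_ ?_ ?_ ?_ ?_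
    · intro t ht
      replace ht := Fintype.mem_piFinset.1 ht
      refine Fintype.mem_piFinset.2 ?_
      exact fun j => hD j ▸ ht (π j)
    · intro t ht
      replace ht := Fintype.mem_piFinset.1 ht
      refine Fintype.mem_piFinset.2 ?_
      exact fun j => hD j ▸ ht (π j)
    · intro t _; ext j; simp [hπ j]
    · intro t _; ext j; simp [hπ j]
    · intro t _
      have a1 : w ((A.image π).piecewise (t ∘ π) x) = w x := hw fun j hj => by
        rw [piecewise_eq_of_notMem]
        rw [hmemπ]; exact hj.2
      have a2 : G ((A.image π).piecewise (t ∘ π) x) = G x := hG fun j hj => by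
        rw [piecewise_eq_of_notMem]
        rw [hmemπ]; exact hj
      have a3 : G (A.piecewise ((A.image π).piecewise (t ∘ π) x ∘ π)
          ((A.image π).piecewise (t ∘ π) x)) = G (A.piecewise t x) := hG fun j hj => by
        by_cases hjA : j ∈ A
        · have : π j ∈ A.image π := mem_image_of_mem π hjA
          simp [-mem_image, hjA, this, hπ j]
        · have : j ∉ A.image π := by rw [hmemπ]; exact hj
          simp [-mem_image, hjA, this]
      simp only [a1, a2, a3]
  rw [e1, ← e2, Complex.ofReal_re]
  refine (norm_sq_expect_mul_le _ _ hw₀ _).trans ?_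
  refine mul_le_mul_of_nonneg_left (expect_le_expect fun x _ => ?_)
    (expect_nonneg fun x _ => hw₀ x)
  refine mul_le_mul_of_nonneg_left ?_ (hw₀ x)
  refine pow_le_pow_left₀ (norm_nonneg _) ?_ 2
  rw [norm_mul]
  exact mul_le_of_le_one_left (norm_nonneg _) (hg₁ x)

end Averages
-- Orthogonality of characters, Weyl differencing, and counting by characters.
section CharacterSums

variable {p : ℕ} [Fact p.Prime]

theorem sum_stdAddChar_comp {G : Type*} [AddCommGroup G] [Fintype G] [DecidableEq G]
    (f : G →+ ZMod p) :
    ∑ x, ZMod.stdAddChar (f x) = if f = 0 then (Fintype.card G : ℂ) else 0 := by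
  have h := AddChar.sum_eq_ite ((ZMod.stdAddChar (N := p)).compAddMonoidHom f)
  have h0 : (ZMod.stdAddChar (N := p)).compAddMonoidHom f = 0 ↔ f = 0 := by
    constructor
    · intro h
      ext x
      have := DFunLike.congr_fun h x
      simp only [AddChar.compAddMonoidHom_apply, AddChar.zero_apply] at this
      exact ZMod.injective_stdAddChar (by simpa using this)
    · rintro rfl
      ext x
      simp
  simp only [AddChar.compAddMonoidHom_apply, h0] at h
  exact h

open ComplexConjugate in
/-- Weyl differencing for a quadratic phase. -/
theorem norm_sq_sum_quadratic_le {G : Type*} [AddCommGroup G] [Fintype G] [DecidableEq G]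
    (Q : G → ZMod p) (b : G → G →+ ZMod p) (hQ : ∀ x h, Q (x + h) = Q x + Q h + b h x) :
    ‖∑ x, ZMod.stdAddChar (Q x)‖ ^ 2
      ≤ (Fintype.card G : ℝ) * ((univ.filter fun h => b h = 0).card : ℝ) := by
  have key : ((‖∑ x, ZMod.stdAddChar (Q x)‖ ^ 2 : ℝ) : ℂ)
      = ∑ h, ZMod.stdAddChar (Q h) * ∑ x, ZMod.stdAddChar (b h x) := by
    push_cast
    rw [← Complex.conj_mul', map_sum, sum_mul_sum]
    simp_rw [mul_sum]
    rw [sum_comm (s := (univ : Finset G)) (t := (univ : Finset G))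
      (f := fun h x => ZMod.stdAddChar (Q h) * ZMod.stdAddChar (b h x))]
    refine sum_congr rfl fun x _ => ?_
    rw [← Equiv.sum_comp (Equiv.addLeft x)]
    refine sum_congr rfl fun h _ => ?_
    rw [Equiv.coe_addLeft, hQ, ← AddChar.map_neg_eq_conj, ← AddChar.map_add_eq_mul,
      ← AddChar.map_add_eq_mul]
    congr 1
    ring
  have h2 : ‖∑ x, ZMod.stdAddChar (Q x)‖ ^ 2
      = ‖∑ h, ZMod.stdAddChar (Q h) * ∑ x, ZMod.stdAddChar (b h x)‖ := by
    rw [← key, Complex.norm_real, Real.norm_of_nonneg (by positivity)]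
  rw [h2]
  refine (norm_sum_le _ _).trans ?_
  simp_rw [sum_stdAddChar_comp, norm_mul, AddChar.norm_apply, one_mul]
  rw [mul_comm, card_filter]
  push_cast
  rw [sum_mul]
  refine sum_le_sum fun h _ => ?_
  split_ifs <;> simp

/-- Fourier inversion of the condition `φ x = v`: the frequency `c = 0` contributes the main term
`|Ω|`, and each of the fewer than `p ^ |C|` others at most `η`. -/
theorem abs_card_mul_pow_sub_card_le {Ω C : Type*} [Fintype Ω] [Fintype C] [DecidableEq C]
    (φ : Ω → C → ZMod p) (v : C → ZMod p) {η : ℝ} (hη₀ : 0 ≤ η)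
    (hη : ∀ c : C → ZMod p, c ≠ 0 → ‖∑ x, ZMod.stdAddChar (∑ i, c i * φ x i)‖ ≤ η) :
    |((univ.filter fun x => φ x = v).card : ℝ) * (p : ℝ) ^ Fintype.card C - Fintype.card Ω|
      ≤ (p : ℝ) ^ Fintype.card C * η := by
  have hcard : (Fintype.card (C → ZMod p) : ℝ) = (p : ℝ) ^ Fintype.card C := by
    simp [ZMod.card]
  let dot : (C → ZMod p) → (C → ZMod p) →+ ZMod p := fun u =>
    { toFun := fun c => ∑ i, c i * u i
      map_zero' := by simp
      map_add' := fun a b => by simp [add_mul, sum_add_distrib] }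
  have hdot : ∀ u, dot u = 0 ↔ u = 0 := by
    intro u
    constructor
    · intro h
      ext i
      have := DFunLike.congr_fun h (Pi.single i 1)
      simpa [dot, Pi.single_apply] using this
    · rintro rfl
      ext c
      simp [dot]
  have e1 : (((univ.filter fun x => φ x = v).card : ℝ) * (p : ℝ) ^ Fintype.card C : ℂ)
      = ∑ c : C → ZMod p, ZMod.stdAddChar (-∑ i, c i * v i) *
          ∑ x, ZMod.stdAddChar (∑ i, c i * φ x i) := by
    simp_rw [mul_sum]
    rw [sum_comm]
    have : ∀ x, ∑ c : C → ZMod p, ZMod.stdAddChar (-∑ i, c i * v i) *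
        ZMod.stdAddChar (∑ i, c i * φ x i)
        = if φ x = v then ((p : ℝ) : ℂ) ^ Fintype.card C else 0 := by
      intro x
      have h := sum_stdAddChar_comp (dot (φ x - v))
      simp only [hdot, sub_eq_zero] at h
      have h3 : (Fintype.card (C → ZMod p) : ℂ) = ((p : ℝ) : ℂ) ^ Fintype.card C := by
        exact_mod_cast hcard
      rw [h3] at h
      rw [← h]
      refine sum_congr rfl fun c _ => ?_
      rw [← AddChar.map_add_eq_mul]
      congr 1
      simp [dot, mul_sub, sum_sub_distrib]
      ring
    simp_rw [this]
    rw [card_filter]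
    push_cast
    rw [sum_mul]
    refine sum_congr rfl fun x _ => ?_
    split_ifs <;> simp
  rw [← add_sum_erase _ _ (mem_univ (0 : C → ZMod p))] at e1
  simp only [Pi.zero_apply, zero_mul, sum_const_zero, neg_zero, AddChar.map_zero_eq_one,
    sum_const, one_mul, card_univ, nsmul_eq_mul, mul_one] at e1
  have hη0 : (univ.erase (0 : C → ZMod p)).card * η ≤ (p : ℝ) ^ Fintype.card C * η := by
    refine mul_le_mul_of_nonneg_right ?_ hη₀
    rw [← hcard]
    exact_mod_cast card_le_univ _
  have e2 : ((((univ.filter fun x => φ x = v).card : ℝ) * (p : ℝ) ^ Fintype.card C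
      - Fintype.card Ω : ℝ) : ℂ) = ∑ c ∈ univ.erase (0 : C → ZMod p),
        ZMod.stdAddChar (-∑ i, c i * v i) * ∑ x, ZMod.stdAddChar (∑ i, c i * φ x i) := by
    push_cast at e1 ⊢
    rw [e1]
    ring
  rw [← Real.norm_eq_abs, ← Complex.norm_real, e2]
  refine (norm_sum_le _ _).trans (le_trans ?_ hη0)
  rw [← nsmul_eq_mul]
  refine sum_le_card_nsmul _ _ _ fun c hc => ?_
  rw [norm_mul, AddChar.norm_apply, one_mul]
  exact hη c (ne_of_mem_erase hc)

end CharacterSums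
-- Exponential sums of quadratic phases in several vectors.
section QuadraticPhase

variable {p n : ℕ} [Fact p.Prime] {J S : Type*} [Fintype J] [DecidableEq J] [Fintype S]

theorem dotProduct_mulVec_comm_of_isSymm {N : Matrix (Fin n) (Fin n) (ZMod p)}
    (hN : N.IsSymm) (x y : Vec p n) :
    dotProduct x (N.mulVec y) = dotProduct y (N.mulVec x) := by
  rw [Matrix.dotProduct_mulVec, ← Matrix.mulVec_transpose, hN.eq, dotProduct_comm]

/-- The coefficient of the `j`-th coordinate in the polarization of
`x ↦ ∑ s, x_{b(s)₁}ᵀ N_s x_{b(s)₂}`. -/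
def polarCoeff (N : S → Matrix (Fin n) (Fin n) (ZMod p)) (b : S → J × J) (j : J) :
    (J → Vec p n) →ₗ[ZMod p] Vec p n :=
  ∑ s, ((if (b s).1 = j then (N s).mulVecLin ∘ₗ LinearMap.proj (b s).2 else 0) +
    if (b s).2 = j then (N s).mulVecLin ∘ₗ LinearMap.proj (b s).1 else 0)

theorem card_vec_pi : (Fintype.card (J → Vec p n) : ℝ) = (p : ℝ) ^ (n * Fintype.card J) := by
  simp [ZMod.card, pow_mul]

/-- Weyl differencing reduces the sum to counting the `h` that annihilate the polarized form. Such
`h` kill the coefficient `L` of one coordinate of `s₀`, and the range of `L` contains that of `N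
s₀`. This saves `p ^ (2 * t)` in the square, hence `p ^ t` in the sum. The hypotheses on `b` say
that the pairs are distinct as unordered pairs, so that no other form can cancel `N s₀`. -/
theorem norm_sum_quadratic_mul_pow_le (hp : 2 < p) (f : (J → Vec p n) →+ ZMod p)
    (N : S → Matrix (Fin n) (Fin n) (ZMod p)) (hN : ∀ s, (N s).IsSymm) (b : S → J × J)
    (hb : Function.Injective b) (hb' : ∀ s s', b s = (b s').swap → s = s')
    (t : ℕ) (s₀ : S) (ht : 2 * t ≤ (N s₀).rank) :
    ‖∑ x : J → Vec p n, ZMod.stdAddChar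
        (f x + ∑ s, dotProduct (x (b s).1) ((N s).mulVec (x (b s).2)))‖ * (p : ℝ) ^ t
      ≤ (p : ℝ) ^ (n * Fintype.card J) := by
  have hp0 : (0 : ℝ) < p := by exact_mod_cast (by omega : 0 < p)
  let B : (J → Vec p n) → (J → Vec p n) →+ ZMod p := fun h =>
    { toFun := fun x => ∑ s, (dotProduct (x (b s).1) ((N s).mulVec (h (b s).2)) +
        dotProduct (x (b s).2) ((N s).mulVec (h (b s).1)))
      map_zero' := by simp
      map_add' := fun x y => by
        simp only [Pi.add_apply, add_dotProduct, ← sum_add_distrib]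
        exact sum_congr rfl fun s _ => by ring }
  have h1 := norm_sq_sum_quadratic_le
    (fun x : J → Vec p n => f x + ∑ s, dotProduct (x (b s).1) ((N s).mulVec (x (b s).2))) B (by
      intro x h
      simp only [B, AddMonoidHom.coe_mk, ZeroHom.coe_mk, map_add, Pi.add_apply, add_dotProduct,
        Matrix.mulVec_add, dotProduct_add, sum_add_distrib]
      have : ∑ s, dotProduct (h (b s).1) ((N s).mulVec (x (b s).2))
          = ∑ s, dotProduct (x (b s).2) ((N s).mulVec (h (b s).1)) :=
        sum_congr rfl fun s _ => dotProduct_mulVec_comm_of_isSymm (hN s) _ _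
      rw [this]
      ring)
  set L := polarCoeff N b (b s₀).1 with hL
  have hker : ∀ h, B h = 0 → h ∈ LinearMap.ker L := by
    intro h hh
    rw [LinearMap.mem_ker]
    refine dotProduct_eq_zero _ fun v => ?_
    have h2 := DFunLike.congr_fun hh (Pi.single (b s₀).1 v)
    simp only [B, AddMonoidHom.coe_mk, ZeroHom.coe_mk, AddMonoidHom.zero_apply] at h2
    rw [dotProduct_comm, ← h2, hL, polarCoeff, LinearMap.sum_apply, dotProduct_sum]
    refine sum_congr rfl fun s _ => ?_
    rw [LinearMap.add_apply, dotProduct_add]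
    congr 1
    · by_cases hs : (b s).1 = (b s₀).1 <;> simp [hs]
    · by_cases hs : (b s).2 = (b s₀).1 <;> simp [hs]
  have hrange : 2 * t ≤ Module.finrank (ZMod p) (LinearMap.range L) := by
    refine ht.trans ?_
    rw [Matrix.rank]
    refine Submodule.finrank_mono ?_
    rintro _ ⟨v, rfl⟩
    -- A diagonal pair is polarized to `2 • N s₀`, an off-diagonal one to `N s₀`; the diagonal case
    -- is where `p` must be odd.
    have hsingle : ∃ c : ZMod p, c ≠ 0 ∧
        L (Pi.single (b s₀).2 v) = c • (N s₀).mulVec v := by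
      have h2 : (2 : ZMod p) ≠ 0 := by
        intro h
        have h3 : ((2 : ℕ) : ZMod p) = 0 := by exact_mod_cast h
        rw [ZMod.natCast_eq_zero_iff] at h3
        exact absurd (Nat.le_of_dvd (by norm_num) h3) (by omega)
      by_cases hd : (b s₀).1 = (b s₀).2
      · refine ⟨2, h2, ?_⟩
        rw [hL, polarCoeff, LinearMap.sum_apply, sum_eq_single s₀]
        · simp [hd, two_smul]
        · intro s _ hs
          have hne : ¬ ((b s).1 = (b s₀).2 ∧ (b s).2 = (b s₀).2) := fun h =>
            hs (hb (Prod.ext (h.1.trans hd.symm) h.2))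
          rw [LinearMap.add_apply, hd]
          by_cases ha : (b s).1 = (b s₀).2
          · have hc : (b s).2 ≠ (b s₀).2 := fun h => hne ⟨ha, h⟩
            simp [ha, hc]
          · by_cases hc : (b s).2 = (b s₀).2 <;> simp [ha, hc]
        · simp
      · refine ⟨1, one_ne_zero, ?_⟩
        rw [hL, polarCoeff, LinearMap.sum_apply, sum_eq_single s₀]
        · simp [Ne.symm hd]
        · intro s _ hs
          have hne : ¬ ((b s).1 = (b s₀).1 ∧ (b s).2 = (b s₀).2) := fun h =>
            hs (hb (Prod.ext h.1 h.2))
          have hne' : ¬ ((b s).2 = (b s₀).1 ∧ (b s).1 = (b s₀).2) := fun h =>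
            hs (hb' _ _ (Prod.ext h.2 h.1))
          rw [LinearMap.add_apply]
          have z1 : (if (b s).1 = (b s₀).1 then (N s).mulVecLin ∘ₗ LinearMap.proj (b s).2
              else 0 : (J → Vec p n) →ₗ[ZMod p] Vec p n) (Pi.single (b s₀).2 v) = 0 := by
            by_cases ha : (b s).1 = (b s₀).1
            · have hc : (b s).2 ≠ (b s₀).2 := fun h => hne ⟨ha, h⟩
              simp [ha, hc]
            · simp [ha]
          have z2 : (if (b s).2 = (b s₀).1 then (N s).mulVecLin ∘ₗ LinearMap.proj (b s).1
              else 0 : (J → Vec p n) →ₗ[ZMod p] Vec p n) (Pi.single (b s₀).2 v) = 0 := by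
            by_cases ha : (b s).2 = (b s₀).1
            · have hc : (b s).1 ≠ (b s₀).2 := fun h => hne' ⟨ha, h⟩
              simp [ha, hc]
            · simp [ha]
          rw [z1, z2, add_zero]
        · simp
    obtain ⟨c, hc, hcv⟩ := hsingle
    refine ⟨c⁻¹ • Pi.single (b s₀).2 v, ?_⟩
    rw [map_smul, hcv, smul_smul, inv_mul_cancel₀ hc, one_smul]
    rfl
  have hcardker : ((univ.filter fun h => B h = 0).card : ℝ) * (p : ℝ) ^ (2 * t)
      ≤ (p : ℝ) ^ (n * Fintype.card J) := by
    have h3 : (univ.filter fun h => B h = 0).card ≤ p ^ Module.finrank (ZMod p) (LinearMap.ker L) := by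
      have h4 : Nat.card (LinearMap.ker L) = p ^ Module.finrank (ZMod p) (LinearMap.ker L) := by
        rw [Module.natCard_eq_pow_finrank (K := ZMod p), Nat.card_zmod]
      rw [← h4]
      have h5 : (univ.filter fun h => B h = 0).card
          = Nat.card {h // h ∈ univ.filter fun h => B h = 0} :=
        (Nat.card_eq_fintype_card.trans (Fintype.card_coe _)).symm
      rw [h5]
      exact Nat.card_le_card_of_injective
        (fun h => (⟨h.1, hker h.1 (mem_filter.1 h.2).2⟩ : LinearMap.ker L))
        fun x y hxy => Subtype.ext (congrArg (fun z : LinearMap.ker L => z.1) hxy)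
    have h6 := LinearMap.finrank_range_add_finrank_ker L
    have h7 : Module.finrank (ZMod p) (J → Vec p n) = n * Fintype.card J := by
      rw [Module.finrank_pi_fintype]
      simp [mul_comm]
    have h8 : (univ.filter fun h => B h = 0).card * p ^ (2 * t) ≤ p ^ (n * Fintype.card J) := by
      refine (Nat.mul_le_mul_right _ h3).trans ?_
      rw [← pow_add]
      exact Nat.pow_le_pow_right (by omega) (by omega)
    exact_mod_cast h8
  refine le_of_sq_le_sq ?_ (by positivity)
  rw [mul_pow, ← pow_mul, mul_comm t 2]
  rw [card_vec_pi] at h1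
  calc _ ≤ (p : ℝ) ^ (n * Fintype.card J) *
        ((univ.filter fun h => B h = 0).card : ℝ) * (p : ℝ) ^ (2 * t) := by
        gcongr
    _ ≤ _ := by
      rw [mul_assoc, sq]
      gcongr

end QuadraticPhase
-- Counting solutions of linear and quadratic constraints.
section Constraints

variable {p n l q : ℕ} [Fact p.Prime] {J P S : Type*} [Fintype J] [DecidableEq J]
  [Fintype P] [DecidableEq P] [Fintype S] [DecidableEq S]

/-- A nonzero frequency with some quadratic component is handled by the rank bound. A purely linear
one gives a nonzero homomorphism, because the `r i` are independent and `a` is injective, so its sum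
vanishes. -/
theorem QuadraticFactor.abs_card_constraints_le (B : QuadraticFactor p n l q) (hp : 2 < p) (t : ℕ)
    (hB : ∀ c : Fin q → ZMod p, c ≠ 0 → 2 * t ≤ (∑ j, c j • B.M j).rank)
    (a : P → J) (ha : Function.Injective a) (b : S → J × J) (hb : Function.Injective b)
    (hb' : ∀ s s', b s = (b s').swap → s = s')
    (u : P → Fin l → ZMod p) (v : S → Fin q → ZMod p) :
    |((univ.filter fun x : J → Vec p n => (∀ k i, dotProduct (x (a k)) (B.r i) = u k i) ∧
        ∀ s j, dotProduct (x (b s).1) ((B.M j).mulVec (x (b s).2)) = v s j).card : ℝ) *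
          (p : ℝ) ^ (Fintype.card P * l + Fintype.card S * q) - (p : ℝ) ^ (n * Fintype.card J)|
      ≤ (p : ℝ) ^ (Fintype.card P * l + Fintype.card S * q) *
          ((p : ℝ) ^ (n * Fintype.card J) / (p : ℝ) ^ t) := by
  have hp0 : (0 : ℝ) < p := by exact_mod_cast (by omega : 0 < p)
  let φ : (J → Vec p n) → ((P × Fin l) ⊕ (S × Fin q)) → ZMod p := fun x =>
    Sum.elim (fun k => dotProduct (x (a k.1)) (B.r k.2))
      fun s => dotProduct (x (b s.1).1) ((B.M s.2).mulVec (x (b s.1).2))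
  let w : ((P × Fin l) ⊕ (S × Fin q)) → ZMod p :=
    Sum.elim (fun k => u k.1 k.2) fun s => v s.1 s.2
  have h := abs_card_mul_pow_sub_card_le φ w
    (η := (p : ℝ) ^ (n * Fintype.card J) / (p : ℝ) ^ t) (by positivity) (by
      intro c hc
      let f : (J → Vec p n) →+ ZMod p :=
        { toFun := fun x => ∑ k, dotProduct (x (a k)) (∑ i, c (Sum.inl (k, i)) • B.r i)
          map_zero' := by simp
          map_add' := fun x y => by
            simp only [Pi.add_apply, add_dotProduct, ← sum_add_distrib] }
      let N : S → Matrix (Fin n) (Fin n) (ZMod p) := fun s => ∑ j, c (Sum.inr (s, j)) • B.M j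
      have hN : ∀ s, (N s).IsSymm := by
        intro s
        simp only [N, Matrix.IsSymm, Matrix.transpose_sum, Matrix.transpose_smul]
        exact sum_congr rfl fun j _ => by rw [(B.isSymm j).eq]
      have hphase : ∀ x, ∑ i, c i * φ x i
          = f x + ∑ s, dotProduct (x (b s).1) ((N s).mulVec (x (b s).2)) := by
        intro x
        rw [Fintype.sum_sum_type, Fintype.sum_prod_type, Fintype.sum_prod_type]
        congr 1
        · refine sum_congr rfl fun k _ => ?_
          rw [dotProduct_sum]
          exact sum_congr rfl fun i _ => by simp [φ, dotProduct_smul]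
        · refine sum_congr rfl fun s _ => ?_
          simp only [N, Matrix.sum_mulVec, dotProduct_sum, Matrix.smul_mulVec, dotProduct_smul, φ,
            Sum.elim_inr, smul_eq_mul]
      simp_rw [hphase]
      by_cases hs : ∃ s, (fun j => c (Sum.inr (s, j))) ≠ 0
      · obtain ⟨s₀, hs₀⟩ := hs
        rw [le_div_iff₀ (by positivity)]
        exact norm_sum_quadratic_mul_pow_le hp f N hN b hb hb' t s₀ (hB _ hs₀)
      · push Not at hs
        have hN0 : ∀ s, N s = 0 := fun s =>
          sum_eq_zero fun j _ => by rw [show c (Sum.inr (s, j)) = 0 from congrFun (hs s) j, zero_smul]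
        simp only [hN0, Matrix.zero_mulVec, dotProduct_zero, sum_const_zero, add_zero]
        rw [sum_stdAddChar_comp, if_neg]
        · simp only [norm_zero]
          positivity
        · intro hf
          have hl : ∀ k, ∑ i, c (Sum.inl (k, i)) • B.r i = 0 := by
            intro k
            refine dotProduct_eq_zero _ fun y => ?_
            have h1 := DFunLike.congr_fun hf (Pi.single (a k) y)
            simp only [f, AddMonoidHom.coe_mk, ZeroHom.coe_mk, AddMonoidHom.zero_apply] at h1
            rw [sum_eq_single k] at h1
            · simpa [dotProduct_comm] using h1
            · intro k' _ hk'
              rw [Pi.single_eq_of_ne (fun h => hk' (ha h))]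
              simp
            · simp
          apply hc
          ext (⟨k, i⟩ | ⟨s, j⟩)
          · exact Fintype.linearIndependent_iff.1 B.linearIndependent _ (hl k) i
          · exact congrFun (hs s) j)
  have hcard : Fintype.card ((P × Fin l) ⊕ (S × Fin q))
      = Fintype.card P * l + Fintype.card S * q := by simp
  rw [hcard, card_vec_pi] at h
  have hset : (univ.filter fun x : J → Vec p n => φ x = w) =
      univ.filter fun x : J → Vec p n => (∀ k i, dotProduct (x (a k)) (B.r i) = u k i) ∧
        ∀ s j, dotProduct (x (b s).1) ((B.M j).mulVec (x (b s).2)) = v s j := by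
    ext x
    simp only [mem_filter, mem_univ, true_and, funext_iff, Sum.forall, Prod.forall, φ, w,
      Sum.elim_inl, Sum.elim_inr]
  rw [hset] at h
  exact h

end Constraints
-- Bernoulli's inequality bounds `(1 - η) ^ (k + 2)` from below, and `(1 - η) * (1 + η) ≤ 1`
-- converts upper bounds on the denominator into lower bounds on the quotient. The quotient in view
-- is the average of a product of weights, written through normalized cardinalities.
theorem abs_div_mul_prod_sub_one_le {ι : Type*} (s : Finset ι) {η a b : ℝ} {f : ι → ℝ}
    (hη : 0 ≤ η) (hs : ((s.card : ℝ) + 2) * η ≤ 1 / 2) (ha : |a - 1| ≤ η) (hb : |b - 1| ≤ η)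
    (hf : ∀ i ∈ s, |f i - 1| ≤ η) :
    |a / (b * ∏ i ∈ s, f i) - 1| ≤ 2 * ((s.card : ℝ) + 2) * η := by
  set k := s.card with hk
  have hk0 : (0 : ℝ) ≤ k := by positivity
  have hη2 : η ≤ 1 / 4 := by nlinarith
  rw [abs_le] at ha hb
  have hlow : (1 - η) ^ (k + 1) ≤ b * ∏ i ∈ s, f i := by
    rw [pow_succ', hk, ← prod_const]
    refine mul_le_mul (by linarith) ?_ (prod_nonneg fun _ _ => by linarith) (by linarith)
    exact prod_le_prod (fun _ _ => by linarith) fun i hi => by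
      have := abs_le.1 (hf i hi); linarith
  have hupp : b * ∏ i ∈ s, f i ≤ (1 + η) ^ (k + 1) := by
    rw [pow_succ', hk, ← prod_const]
    refine mul_le_mul (by linarith) ?_ (prod_nonneg fun i hi => ?_) (by linarith)
    · exact prod_le_prod (fun i hi => by have := abs_le.1 (hf i hi); linarith) fun i hi => by
        have := abs_le.1 (hf i hi); linarith
    · have := abs_le.1 (hf i hi); linarith
  have hbern : 1 - ((k : ℝ) + 2) * η ≤ (1 - η) ^ (k + 2) := by
    have := one_add_mul_le_pow (a := -η) (by linarith) (k + 2)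
    push_cast at this
    rw [← sub_eq_add_neg] at this
    linarith
  have hpos : 0 < (1 - η) ^ (k + 1) := pow_pos (by linarith) _
  have hD : 0 < b * ∏ i ∈ s, f i := hpos.trans_le hlow
  have h1 : (1 - η) * (1 + η) ≤ 1 := by nlinarith
  have hprod : (1 - η) ^ (k + 1) * (1 + η) ^ (k + 1) ≤ 1 := by
    rw [← mul_pow]
    exact pow_le_one₀ (by nlinarith) h1
  rw [abs_le]
  constructor
  · rw [neg_le_sub_iff_le_add, ← sub_le_iff_le_add, le_div_iff₀ hD]
    have h2 : 1 - 2 * ((k : ℝ) + 2) * η ≤ (1 - η) ^ (k + 2) := by nlinarith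
    calc _ ≤ (1 - η) ^ (k + 2) * (b * ∏ i ∈ s, f i) := by gcongr
      _ ≤ (1 - η) ^ (k + 2) * (1 + η) ^ (k + 1) := by
        have : 0 ≤ (1 - η) ^ (k + 2) := pow_nonneg (by linarith) _
        gcongr
      _ = (1 - η) * ((1 - η) ^ (k + 1) * (1 + η) ^ (k + 1)) := by ring
      _ ≤ (1 - η) * 1 := by
        have : 0 ≤ 1 - η := by linarith
        gcongr
      _ ≤ a := by linarith
  · rw [sub_le_iff_le_add, div_le_iff₀ hD]
    set y := ((k : ℝ) + 2) * η with hy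
    have hy0 : 0 ≤ y := by positivity
    have h3 : 1 ≤ (2 * y + 1) * (1 - η) ^ (k + 2) := by
      calc 1 ≤ (2 * y + 1) * (1 - y) := by nlinarith
        _ ≤ _ := by gcongr
    have h4 : a * (1 - η) ≤ 1 := by nlinarith
    have h5 : a ≤ (2 * y + 1) * (1 - η) ^ (k + 1) := by
      have h6 : a * (1 - η) ≤ (2 * y + 1) * (1 - η) ^ (k + 1) * (1 - η) := by
        calc _ ≤ (1 : ℝ) := h4
          _ ≤ _ := h3
          _ = _ := by ring
      exact le_of_mul_le_mul_right h6 (by linarith)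
    calc a ≤ _ := h5
      _ ≤ (2 * y + 1) * (b * ∏ i ∈ s, f i) := by gcongr
      _ = _ := by rw [hy]; ring

/-! ### Quasirandomness of the bilinear weights on atoms. -/

section Normalized

set_option linter.unusedSectionVars false

variable {p n l q : ℕ} [Fact p.Prime] {J : Type*} [Fintype J] [DecidableEq J]

theorem abs_div_sub_one_le {c R pD pt ps : ℝ} (hR : 0 < R) (hpt : 0 < pt) (hps : 0 < ps)
    (h : |c * pD - R| ≤ pD * (R / pt)) (hD : pD * ps ≤ pt) :
    |c * pD / R - 1| ≤ 1 / ps := by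
  have e : c * pD / R - 1 = (c * pD - R) / R := by field_simp
  rw [e, abs_div, abs_of_pos hR, div_le_iff₀ hR]
  refine h.trans ?_
  rw [mul_div_assoc', div_le_iff₀ hpt]
  calc pD * R = (pD * ps) * R / ps := by field_simp
    _ ≤ pt * R / ps := by gcongr
    _ = _ := by ring

theorem QuadraticFactor.prod_mu_eq (B : QuadraticFactor p n l q) (S : Finset (J × J))
    (d : J × J → Fin q → ZMod p) (x : J → Vec p n) :
    ∏ z ∈ S, B.mu (d z) (x z.1) (x z.2) =
      if ∀ z ∈ S, (x z.1, x z.2) ∈ B.beta (d z) then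
        ∏ z ∈ S, (Fintype.card (Vec p n) : ℝ) ^ 2 / ((B.beta (d z)).card : ℝ) else 0 := by
  split_ifs with hx
  · exact prod_congr rfl fun z hz => by rw [QuadraticFactor.mu, if_pos (hx z hz)]
  · push Not at hx
    obtain ⟨z, hz, hxz⟩ := hx
    exact prod_eq_zero hz (by rw [QuadraticFactor.mu, if_neg hxz])

variable (B : QuadraticFactor p n l q) (hp : 2 < p) (K s : ℕ)
  (hB : ∀ c : Fin q → ZMod p, c ≠ 0 → 2 * (K * (l + q) + s) ≤ (∑ j, c j • B.M j).rank)

include hp hB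

/-- Rank `2 * (K * (l + q) + s)` gives a relative character error `p ^ (-(K * (l + q) + s))`. The
term `K * (l + q)` pays for the number of scalar constraints, and a saving of `p ^ (-s)` remains. -/
theorem QuadraticFactor.abs_card_beta_le (hK : 1 ≤ K) (d : Fin q → ZMod p) :
    |((B.beta d).card : ℝ) * (p : ℝ) ^ q / (p : ℝ) ^ (2 * n) - 1| ≤ 1 / (p : ℝ) ^ s := by
  have hp0 : (0 : ℝ) < p := by exact_mod_cast (by omega : 0 < p)
  have h := B.abs_card_constraints_le hp (K * (l + q) + s) hB (P := Empty) (J := Bool) (S := Unit)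
    (fun x => x.elim) (fun x => x.elim) (fun _ => (false, true)) (fun _ _ _ => rfl)
    (fun _ _ _ => rfl) (fun x => x.elim) (fun _ => d)
  have hcard : (univ.filter fun x : Bool → Vec p n =>
      (∀ (k : Empty) (i : Fin l), dotProduct (x k.elim) (B.r i) = (k.elim : Fin l → ZMod p) i) ∧
        ∀ (_ : Unit) j, dotProduct (x false) ((B.M j).mulVec (x true)) = d j).card
      = (B.beta d).card := by
    refine card_nbij' (fun x => (x false, x true)) (fun z b => cond b z.2 z.1) ?_ ?_ ?_ ?_
    · intro x hx
      simpa [QuadraticFactor.beta] using hx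
    · intro z hz
      simpa [QuadraticFactor.beta] using hz
    · intro x _
      ext b : 1
      cases b <;> rfl
    · intro z _
      rfl
  refine abs_div_sub_one_le (by positivity) (pt := (p : ℝ) ^ (K * (l + q) + s)) (by positivity)
    (by positivity) ?_ ?_
  · simp only [Fintype.card_empty, zero_mul, Fintype.card_unit, one_mul, zero_add,
      Fintype.card_bool] at h
    rw [mul_comm 2 n]
    rw [← hcard]
    exact h
  · rw [← pow_add]
    refine pow_le_pow_right₀ (by exact_mod_cast (by omega : 1 ≤ p)) ?_
    nlinarith

/-- The quadratic condition of an atom is the bilinear one on a diagonal pair `(j, j)`, so atoms and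
level sets form one system indexed by `J ⊕ S`. The hypothesis `hS` excludes loops and opposite
orientations, keeping all these pairs distinct. -/
theorem QuadraticFactor.abs_card_tuples_le (a : J → AtomLabel p l q) (S : Finset (J × J))
    (hS : ∀ z ∈ S, z.swap ∉ S) (hK : Fintype.card J + S.card ≤ K) (d : J × J → Fin q → ZMod p) :
    |(((Fintype.piFinset fun j => B.atom (a j)).filter
        fun x => ∀ z ∈ S, (x z.1, x z.2) ∈ B.beta (d z)).card : ℝ) *
          (p : ℝ) ^ ((l + q) * Fintype.card J + q * S.card) / (p : ℝ) ^ (n * Fintype.card J) - 1|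
      ≤ 1 / (p : ℝ) ^ s := by
  have hp0 : (0 : ℝ) < p := by exact_mod_cast (by omega : 0 < p)
  have h := B.abs_card_constraints_le hp (K * (l + q) + s) hB (P := J) (J := J) (S := J ⊕ S)
    id Function.injective_id (Sum.elim (fun j => (j, j)) fun z => z.1) (by
      rintro (j | ⟨z, hz⟩) (j' | ⟨z', hz'⟩) h
      · simpa using h
      · simp only [Sum.elim_inl, Sum.elim_inr] at h
        exact absurd (h ▸ hz' : z'.swap ∈ S) (hS _ hz')
      · simp only [Sum.elim_inl, Sum.elim_inr] at h
        exact absurd (h ▸ hz : z.swap ∈ S) (hS _ hz)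
      · simpa using h) (by
      rintro (j | ⟨z, hz⟩) (j' | ⟨z', hz'⟩) h
      · simp at h
        simp [h]
      · simp only [Sum.elim_inl, Sum.elim_inr] at h
        obtain ⟨x, y⟩ := z'
        simp only [Prod.swap, Prod.mk.injEq] at h
        obtain ⟨rfl, rfl⟩ := h
        exact absurd hz' (hS _ hz')
      · simp only [Sum.elim_inl, Sum.elim_inr, Prod.swap_prod_mk] at h
        subst h
        exact absurd hz (hS _ hz)
      · simp only [Sum.elim_inr] at h
        subst h
        exact absurd hz (hS _ hz'))
    (fun j => (a j).1) (Sum.elim (fun j => (a j).2) fun z => d z.1)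
  have hset : (univ.filter fun x : J → Vec p n =>
      (∀ k i, dotProduct (x (id k)) (B.r i) = (a k).1 i) ∧
        ∀ (z : J ⊕ S) j, dotProduct (x (Sum.elim (fun j => (j, j)) (fun z => z.1) z : J × J).1)
          ((B.M j).mulVec (x (Sum.elim (fun j => (j, j)) (fun z => z.1) z : J × J).2))
          = Sum.elim (fun j => (a j).2) (fun z => d z.1) z j)
      = (Fintype.piFinset fun j => B.atom (a j)).filter
        fun x => ∀ z ∈ S, (x z.1, x z.2) ∈ B.beta (d z) := by
    ext x
    simp only [mem_filter, mem_univ, true_and, id, Sum.forall, Sum.elim_inl, Sum.elim_inr,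
      Fintype.mem_piFinset, QuadraticFactor.atom, QuadraticFactor.beta, Subtype.forall,
      forall_and, and_assoc]
  rw [hset] at h
  have hD : Fintype.card J * l + Fintype.card (J ⊕ S) * q
      = (l + q) * Fintype.card J + q * S.card := by
    simp only [Fintype.card_sum, Fintype.card_coe]
    ring
  rw [hD] at h
  refine abs_div_sub_one_le (by positivity) (pt := (p : ℝ) ^ (K * (l + q) + s)) (by positivity)
    (by positivity) h ?_
  rw [← pow_add]
  refine pow_le_pow_right₀ (by exact_mod_cast (by omega : 1 ≤ p)) ?_
  nlinarith [Nat.zero_le (l * S.card), Nat.mul_le_mul_right (l + q) hK]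

/-- The weights `μ_β` on atoms are jointly quasirandom. -/
theorem QuadraticFactor.abs_expect_prod_mu_le (a : J → AtomLabel p l q) (S : Finset (J × J))
    (hS : ∀ z ∈ S, z.swap ∉ S) (hK₁ : 1 ≤ K) (hK : Fintype.card J + S.card ≤ K)
    (d : J × J → Fin q → ZMod p) {δ : ℝ} (hδ : δ ≤ 1) (hs : 2 * ((K : ℝ) + 2) / 3 ^ s ≤ δ) :
    |(𝔼 x ∈ Fintype.piFinset fun j => B.atom (a j), ∏ z ∈ S, B.mu (d z) (x z.1) (x z.2)) - 1|
      ≤ δ := by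
  have hp0 : (0 : ℝ) < p := by exact_mod_cast (by omega : 0 < p)
  -- Replacing `p` by 3 makes the choice of `s` uniform in the prime.
  have h3p : (3 : ℝ) ^ s ≤ (p : ℝ) ^ s := by
    gcongr
    exact_mod_cast hp
  have hSK : (S.card : ℝ) ≤ K := by exact_mod_cast (by omega : S.card ≤ K)
  have hη : 2 * ((S.card : ℝ) + 2) * (1 / (p : ℝ) ^ s) ≤ δ := by
    refine le_trans ?_ hs
    rw [mul_one_div]
    gcongr
  have h1 := B.abs_card_tuples_le hp K s hB a S hS hK d
  -- With no pairs the count is the size of the product of atoms, the denominator of the average.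
  have h0 := B.abs_card_tuples_le hp K s hB a ∅ (by simp)
    (by rw [card_empty]; omega) d
  simp only [notMem_empty, IsEmpty.forall_iff, implies_true, filter_true, card_empty, mul_zero,
    add_zero] at h0
  have hβ := fun z : J × J => B.abs_card_beta_le hp K s hB hK₁ (d z)
  have hη2 : 1 / (p : ℝ) ^ s ≤ 1 / 4 := by nlinarith [(by positivity : 0 ≤ (S.card : ℝ) * (1 / (p : ℝ) ^ s))]
  have hpos : (0 : ℝ) < ((Fintype.piFinset fun j => B.atom (a j)).card : ℝ) := by
    rw [abs_le] at h0
    by_contra hcon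
    have : ((Fintype.piFinset fun j => B.atom (a j)).card : ℝ) = 0 :=
      le_antisymm (not_lt.1 hcon) (by positivity)
    rw [this, zero_mul, zero_div] at h0
    linarith [h0.1]
  have hβpos : ∀ z, (0 : ℝ) < ((B.beta (d z)).card : ℝ) := by
    intro z
    have h2 := hβ z
    rw [abs_le] at h2
    by_contra hcon
    have : ((B.beta (d z)).card : ℝ) = 0 := le_antisymm (not_lt.1 hcon) (by positivity)
    rw [this, zero_mul, zero_div] at h2
    linarith [h2.1]
  have key := abs_div_mul_prod_sub_one_le S (η := 1 / (p : ℝ) ^ s) (by positivity) (by linarith)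
    h1 h0 fun z _ => hβ z
  refine le_trans (le_of_eq ?_) (key.trans hη)
  congr 2
  rw [expect_eq_sum_div_card]
  have hV : (Fintype.card (Vec p n) : ℝ) ^ 2 = (p : ℝ) ^ (2 * n) := by
    simp [ZMod.card, ← pow_mul, mul_comm]
  simp_rw [QuadraticFactor.prod_mu_eq, hV]
  rw [← sum_filter, sum_const, nsmul_eq_mul]
  simp_rw [prod_div_distrib, prod_mul_distrib, prod_const]
  have : (∏ z ∈ S, ((B.beta (d z)).card : ℝ)) ≠ 0 := prod_ne_zero_iff.2 fun z _ => (hβpos z).ne'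
  rw [pow_add, pow_mul (p : ℝ) q]
  field_simp

end Normalized
-- Doubling vertices in weighted graphs.
section VonNeumann

set_option linter.unusedSectionVars false

variable {I X : Type*} [DecidableEq I]

/-- Exchange of the two copies of a vertex. -/
def flipCopy (j : I × Fin 2) : I × Fin 2 := (j.1, j.2 + 1)

theorem flip_involutive : Function.Involutive (flipCopy : I × Fin 2 → I × Fin 2) := by
  rintro ⟨i, b⟩
  exact Prod.ext rfl ((by decide : ∀ b : Fin 2, b + 1 + 1 = b) b)

/-- Exchange of the two copies of the vertices in `T`. -/
def flipOn (T : Finset I) (j : I × Fin 2) : I × Fin 2 := if j.1 ∈ T then flipCopy j else j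

@[simp]
theorem flipOn_fst (T : Finset I) (j : I × Fin 2) : (flipOn T j).1 = j.1 := by
  unfold flipOn flipCopy; split_ifs <;> rfl

theorem flipOn_involutive (T : Finset I) : Function.Involutive (flipOn T) := by
  intro j
  by_cases h : j.1 ∈ T
  · have h' : (flipCopy j).1 ∈ T := h
    simp [flipOn, h, h', flip_involutive j]
  · simp [flipOn, h]

variable [Fintype I]

/-- Replace the first copies of the vertices in `T` by the second copies. -/
def dup (T : Finset I) (x : I × Fin 2 → X) : I × Fin 2 → X :=
  (univ.filter fun j : I × Fin 2 => j.1 ∈ T ∧ j.2 = 0).piecewise (x ∘ flipCopy) x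

theorem dup_of_mem {T : Finset I} {j : I × Fin 2} (h : j.1 ∈ T → j.2 = 0) (x : I × Fin 2 → X) :
    dup T x j = x (flipOn T j) := by
  by_cases hj : j.1 ∈ T
  · simp [dup, flipOn, hj, h hj]
  · simp [dup, flipOn, hj]

variable (ν : I × I → X → X → ℝ)

/-- The product of the weights of the edges in `S`. -/
def weight (S : Finset ((I × Fin 2) × (I × Fin 2))) (x : I × Fin 2 → X) : ℝ :=
  ∏ z ∈ S, ν (z.1.1, z.2.1) (x z.1) (x z.2)

/-- The edges between two copies of the vertices that lie over an edge in `E` and use the second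
copies only of the vertices in `T`. -/
def doubledEdges (E : Finset (I × I)) (T : Finset I) : Finset ((I × Fin 2) × (I × Fin 2)) :=
  univ.filter fun z => (z.1.1, z.2.1) ∈ E ∧ (z.1.1 ∉ T → z.1.2 = 0) ∧ (z.2.1 ∉ T → z.2.2 = 0)

theorem mem_doubledEdges {E : Finset (I × I)} {T : Finset I} {z : (I × Fin 2) × (I × Fin 2)} :
    z ∈ doubledEdges E T ↔
      (z.1.1, z.2.1) ∈ E ∧ (z.1.1 ∉ T → z.1.2 = 0) ∧ (z.2.1 ∉ T → z.2.2 = 0) := by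
  simp [doubledEdges]

theorem weight_nonneg (hν : ∀ e x y, 0 ≤ ν e x y) (S : Finset ((I × Fin 2) × (I × Fin 2)))
    (x : I × Fin 2 → X) : 0 ≤ weight ν S x :=
  prod_nonneg fun _ _ => hν _ _ _

theorem weight_union {S S' : Finset ((I × Fin 2) × (I × Fin 2))} (h : Disjoint S S')
    (x : I × Fin 2 → X) : weight ν (S ∪ S') x = weight ν S x * weight ν S' x :=
  prod_union h

theorem dependsOn_weight (S : Finset ((I × Fin 2) × (I × Fin 2))) (s : Set (I × Fin 2))
    (h : ∀ z ∈ S, z.1 ∈ s ∧ z.2 ∈ s) : DependsOn (weight ν S) s := by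
  intro x y hxy
  exact prod_congr rfl fun z hz => by rw [hxy _ (h z hz).1, hxy _ (h z hz).2]

/-- `S` with the two copies of the vertices in `T` exchanged. -/
def flipEdges (T : Finset I) (S : Finset ((I × Fin 2) × (I × Fin 2))) :
    Finset ((I × Fin 2) × (I × Fin 2)) :=
  S.image (Prod.map (flipOn T) (flipOn T))

theorem mem_flipEdges {T : Finset I} {S : Finset ((I × Fin 2) × (I × Fin 2))}
    {z : (I × Fin 2) × (I × Fin 2)} :
    z ∈ flipEdges T S ↔ (flipOn T z.1, flipOn T z.2) ∈ S := by
  rw [flipEdges, mem_image]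
  constructor
  · rintro ⟨y, hy, rfl⟩
    simpa [flipOn_involutive T y.1, flipOn_involutive T y.2] using hy
  · intro h
    exact ⟨_, h, by simp [flipOn_involutive T z.1, flipOn_involutive T z.2]⟩

theorem weight_dup {T : Finset I} {S : Finset ((I × Fin 2) × (I × Fin 2))}
    (h : ∀ z ∈ S, (z.1.1 ∈ T → z.1.2 = 0) ∧ (z.2.1 ∈ T → z.2.2 = 0)) (x : I × Fin 2 → X) :
    weight ν S (dup T x) = weight ν (flipEdges T S) x := by
  rw [weight, weight, flipEdges, prod_image]
  · refine prod_congr rfl fun z hz => ?_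
    rw [dup_of_mem (h z hz).1, dup_of_mem (h z hz).2]
    simp
  · exact ((flipOn_involutive T).injective.prodMap (flipOn_involutive T).injective).injOn

open ComplexConjugate

variable {D : I → Finset X} {E : Finset (I × I)} {δ : ℝ}

/-- This is `norm_sq_expect_le` with the first copies of the vertices in `T` doubled and the second
copies as fresh variables. The edges of `S` avoid `T`, so their weight acts as a measure of mass at
most `1 + δ`. -/
theorem norm_sq_expect_dup_le (hν : ∀ e x y, 0 ≤ ν e x y) (T : Finset I)
    (S : Finset ((I × Fin 2) × (I × Fin 2))) (hS : ∀ z ∈ S, z.1.1 ∉ T ∧ z.2.1 ∉ T)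
    (hδ : 𝔼 x ∈ Fintype.piFinset fun j : I × Fin 2 => D j.1, weight ν S x ≤ 1 + δ)
    (g G : (I × Fin 2 → X) → ℂ) (hg₁ : ∀ x, ‖g x‖ ≤ 1) (hg : DependsOn g {j | j.1 ∉ T})
    (hG : DependsOn G {j | j.1 ∈ T → j.2 = 0}) :
    ‖𝔼 x ∈ Fintype.piFinset fun j : I × Fin 2 => D j.1, (weight ν S x : ℂ) * (g x * G x)‖ ^ 2 ≤
      (1 + δ) * ‖𝔼 x ∈ Fintype.piFinset fun j : I × Fin 2 => D j.1,
        (weight ν S x : ℂ) * (G x * conj (G (dup T x)))‖ := by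
  have hsub : {j : I × Fin 2 | j.1 ∉ T} ⊆ {j | j ∉ (univ.filter fun j : I × Fin 2 => j.1 ∈ T ∧ j.2 = 0) ∧
      flipCopy j ∉ univ.filter fun j : I × Fin 2 => j.1 ∈ T ∧ j.2 = 0} := by
    rintro j (hj : j.1 ∉ T)
    simp [flipCopy, hj]
  refine (norm_sq_expect_le (fun j : I × Fin 2 => D j.1) flip_involutive (fun _ => rfl)
    (univ.filter fun j : I × Fin 2 => j.1 ∈ T ∧ j.2 = 0) (weight ν S) (weight_nonneg ν hν S) g G hg₁
    ((dependsOn_weight ν S _ hS).mono hsub) (hg.mono hsub) (hG.mono ?_)).trans ?_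
  · rintro ⟨i, b⟩ hj
    have hj' : i ∈ T → b = 0 := hj
    simp only [Set.mem_ofPred_eq, flipCopy, mem_filter, mem_univ, true_and, not_and]
    intro hi
    rw [hj' hi]
    decide
  · exact (mul_le_mul_of_nonneg_left (Complex.re_le_norm _)
      (expect_nonneg fun x _ => weight_nonneg ν hν S x)).trans
      (mul_le_mul_of_nonneg_right hδ (norm_nonneg _))

/-- Only edges meeting `a` acquire a new copy. A loop at `a` would also produce mixed edges between
its two copies, which flipping does not create. -/
theorem doubledEdges_insert (hE : ∀ i, (i, i) ∉ E) {T : Finset I} {a : I} (ha : a ∉ T) :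
    doubledEdges E (insert a T) = doubledEdges E T ∪
      flipEdges {a} ((doubledEdges E T).filter fun z => ¬ (z.1.1 ≠ a ∧ z.2.1 ≠ a)) := by
  have h01 : ∀ b : Fin 2, b = 0 ∨ b = 1 := by decide
  have h10 : (1 : Fin 2) + 1 = 0 := rfl
  ext ⟨⟨i, b⟩, ⟨j, c⟩⟩
  simp only [mem_union, mem_flipEdges, mem_filter, mem_doubledEdges, mem_insert, flipOn_fst]
  by_cases hi : i = a <;> by_cases hj : j = a <;> rcases h01 b with rfl | rfl <;>
    rcases h01 c with rfl | rfl <;> simp_all [flipOn, flipCopy]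

theorem disjoint_doubledEdges_flipEdges {T : Finset I} {a : I} (ha : a ∉ T) :
    Disjoint (doubledEdges E T)
      (flipEdges {a} ((doubledEdges E T).filter fun z => ¬ (z.1.1 ≠ a ∧ z.2.1 ≠ a))) := by
  have h01 : ∀ b : Fin 2, b = 0 ∨ b = 1 := by decide
  rw [disjoint_left]
  rintro ⟨⟨i, b⟩, ⟨j, c⟩⟩
  simp only [mem_flipEdges, mem_filter, mem_doubledEdges, flipOn_fst]
  by_cases hi : i = a <;> by_cases hj : j = a <;> rcases h01 b with rfl | rfl <;>
    rcases h01 c with rfl | rfl <;> simp_all [flipOn, flipCopy]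

/-- One step of the von Neumann argument. The weights of edges meeting `a` are absorbed into `G` and
doubled with it; those avoiding `a` form the Cauchy–Schwarz measure; the bounded `g`, which ignores
`a`, disappears. -/
theorem norm_sq_expect_doubledEdges_le (hν : ∀ e x y, 0 ≤ ν e x y) (hE : ∀ i, (i, i) ∉ E)
    (hc : ∀ S : Finset ((I × Fin 2) × (I × Fin 2)), (∀ z ∈ S, (z.1.1, z.2.1) ∈ E) →
      |(𝔼 x ∈ Fintype.piFinset fun j : I × Fin 2 => D j.1, weight ν S x) - 1| ≤ δ)
    {T : Finset I} {a : I} (ha : a ∉ T) (g G : (I × Fin 2 → X) → ℂ) (hg₁ : ∀ x, ‖g x‖ ≤ 1)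
    (hg : DependsOn g {j | j.1 ≠ a}) (hG : DependsOn G {j | j ≠ (a, 1)}) :
    ‖𝔼 x ∈ Fintype.piFinset fun j : I × Fin 2 => D j.1,
        (weight ν (doubledEdges E T) x : ℂ) * (g x * G x)‖ ^ 2 ≤
      (1 + δ) * ‖𝔼 x ∈ Fintype.piFinset fun j : I × Fin 2 => D j.1,
        (weight ν (doubledEdges E (insert a T)) x : ℂ) * (G x * conj (G (dup {a} x)))‖ := by
  set S₀ := (doubledEdges E T).filter fun z => z.1.1 ≠ a ∧ z.2.1 ≠ a with hS₀
  set S₁ := (doubledEdges E T).filter fun z => ¬ (z.1.1 ≠ a ∧ z.2.1 ≠ a) with hS₁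
  have hw : ∀ x, weight ν (doubledEdges E T) x = weight ν S₀ x * weight ν S₁ x := fun x =>
    (prod_filter_mul_prod_filter_not _ _ _).symm
  have hvert : ∀ z ∈ doubledEdges E T, (z.1.1 = a → z.1.2 = 0) ∧ (z.2.1 = a → z.2.2 = 0) := by
    intro z hz
    rw [mem_doubledEdges] at hz
    exact ⟨fun h => hz.2.1 (h ▸ ha), fun h => hz.2.2 (h ▸ ha)⟩
  have hset : {j : I × Fin 2 | j ≠ (a, 1)} = {j | j.1 ∈ ({a} : Finset I) → j.2 = 0} := by
    have h01 : ∀ b : Fin 2, b ≠ 1 ↔ b = 0 := by decide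
    ext ⟨i, b⟩
    simp [Prod.ext_iff, h01]
  have h := norm_sq_expect_dup_le ν (D := D) (δ := δ) hν {a} S₀ (by
      intro z hz
      simpa using (mem_filter.1 hz).2) (by
      have := (abs_le.1 (hc S₀ fun z hz => (mem_doubledEdges.1 (mem_filter.1 hz).1).1)).2
      linarith) g (fun x => (weight ν S₁ x : ℂ) * G x) hg₁ (by simpa using hg) (by
      intro x y hxy
      have h1 : weight ν S₁ x = weight ν S₁ y := dependsOn_weight ν S₁
        {j | j.1 ∈ ({a} : Finset I) → j.2 = 0} (fun z hz => by
          have := hvert z (mem_filter.1 hz).1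
          simpa using this) hxy
      have h2 : G x = G y := (hset ▸ hG) hxy
      simp only [h1, h2])
  convert h using 2
  · congr 1
    refine expect_congr rfl fun x _ => ?_
    rw [hw]
    push_cast
    ring
  · congr 1
    refine expect_congr rfl fun x _ => ?_
    have h3 : weight ν S₁ (dup {a} x) = weight ν (flipEdges {a} S₁) x := weight_dup ν (fun z hz => by
      have := hvert z (mem_filter.1 hz).1
      simpa using this) x
    rw [doubledEdges_insert hE ha, weight_union ν (disjoint_doubledEdges_flipEdges ha), hw,
      map_mul, Complex.conj_ofReal, h3]
    push_cast
    ring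

/-- Discarding the weights of all the edges that have a vertex outside `T`. -/
theorem norm_sq_expect_doubledEdges_sub_le (hν : ∀ e x y, 0 ≤ ν e x y)
    (hc : ∀ S : Finset ((I × Fin 2) × (I × Fin 2)), (∀ z ∈ S, (z.1.1, z.2.1) ∈ E) →
      |(𝔼 x ∈ Fintype.piFinset fun j : I × Fin 2 => D j.1, weight ν S x) - 1| ≤ δ)
    (T : Finset I) (g : (I × Fin 2 → X) → ℂ) (hg₁ : ∀ x, ‖g x‖ ≤ 1)
    (hg : DependsOn g {j | j.1 ∈ T}) :
    ‖(𝔼 x ∈ Fintype.piFinset fun j : I × Fin 2 => D j.1,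
          (weight ν (doubledEdges E T) x : ℂ) * g x) -
        𝔼 x ∈ Fintype.piFinset fun j : I × Fin 2 => D j.1,
          (weight ν ((doubledEdges E T).filter fun z => z.1.1 ∈ T ∧ z.2.1 ∈ T) x : ℂ) * g x‖ ^ 2
      ≤ (1 + δ) * (4 * δ) := by
  set S₀ := (doubledEdges E T).filter fun z => z.1.1 ∈ T ∧ z.2.1 ∈ T with hS₀
  set S₁ := (doubledEdges E T).filter fun z => ¬ (z.1.1 ∈ T ∧ z.2.1 ∈ T) with hS₁
  have hw : ∀ x, weight ν (doubledEdges E T) x = weight ν S₀ x * weight ν S₁ x := fun x =>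
    (prod_filter_mul_prod_filter_not _ _ _).symm
  have hvert : ∀ z ∈ doubledEdges E T, (z.1.1 ∈ Tᶜ → z.1.2 = 0) ∧ (z.2.1 ∈ Tᶜ → z.2.2 = 0) := by
    intro z hz
    rw [mem_doubledEdges] at hz
    simpa using hz.2
  have hE₀ : ∀ z ∈ S₀, (z.1.1, z.2.1) ∈ E := fun z hz =>
    (mem_doubledEdges.1 (mem_filter.1 hz).1).1
  have hE₁ : ∀ z ∈ S₁, (z.1.1, z.2.1) ∈ E := fun z hz =>
    (mem_doubledEdges.1 (mem_filter.1 hz).1).1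
  have hE₂ : ∀ z ∈ flipEdges Tᶜ S₁, (z.1.1, z.2.1) ∈ E := fun z hz => by
    have := hE₁ _ (mem_flipEdges.1 hz)
    simpa using this
  have hd₁ : Disjoint S₀ S₁ := disjoint_filter_filter_not _ _ _
  have hd₂ : Disjoint S₀ (flipEdges Tᶜ S₁) := by
    rw [disjoint_left]
    intro z hz hz'
    have h1 := (mem_filter.1 hz).2
    have h2 := (mem_filter.1 (mem_flipEdges.1 hz')).2
    simp only [flipOn_fst] at h2
    exact h2 h1
  have hd₃ : Disjoint S₁ (flipEdges Tᶜ S₁) := by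
    rw [disjoint_left]
    rintro ⟨⟨i, b⟩, ⟨j, c⟩⟩ hz hz'
    have h1 := hvert _ (mem_filter.1 hz).1
    have h2 := hvert _ (mem_filter.1 (mem_flipEdges.1 hz')).1
    have h3 := (mem_filter.1 hz).2
    simp only [mem_compl, flipOn] at h1 h2 h3
    by_cases hi : i ∈ T
    · have hj : j ∉ T := fun hj => h3 ⟨hi, hj⟩
      simp [hj, flipCopy, h1.2 hj] at h2
    · simp [hi, flipCopy, h1.1 hi] at h2
  -- All vertices outside `T` are doubled at once; the function being doubled is the deviation of
  -- the unwanted weights from 1.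
  have h := norm_sq_expect_dup_le ν (D := D) (δ := δ) hν Tᶜ S₀ (by
      intro z hz
      simpa using (mem_filter.1 hz).2) (by
      have := (abs_le.1 (hc S₀ hE₀)).2
      linarith) g (fun x => (weight ν S₁ x : ℂ) - 1) hg₁ (by simpa using hg) (by
      intro x y hxy
      have h1 : weight ν S₁ x = weight ν S₁ y := dependsOn_weight ν S₁
        {j | j.1 ∈ Tᶜ → j.2 = 0} (fun z hz => hvert z (mem_filter.1 hz).1) hxy
      simp only [h1])
  have e1 : (𝔼 x ∈ Fintype.piFinset fun j : I × Fin 2 => D j.1,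
          (weight ν (doubledEdges E T) x : ℂ) * g x) -
        (𝔼 x ∈ Fintype.piFinset fun j : I × Fin 2 => D j.1, (weight ν S₀ x : ℂ) * g x)
      = 𝔼 x ∈ Fintype.piFinset fun j : I × Fin 2 => D j.1,
          (weight ν S₀ x : ℂ) * (g x * ((weight ν S₁ x : ℂ) - 1)) := by
    rw [← expect_sub_distrib]
    refine expect_congr rfl fun x _ => ?_
    rw [hw]
    push_cast
    ring
  -- The square expands into four averages of weights with signs `+ - - +`. Each is within `δ` of 1,
  -- so the main terms cancel and at most `4 * δ` is left.
  have e2 : (𝔼 x ∈ Fintype.piFinset fun j : I × Fin 2 => D j.1, (weight ν S₀ x : ℂ) *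
        (((weight ν S₁ x : ℂ) - 1) * conj ((weight ν S₁ (dup Tᶜ x) : ℂ) - 1)))
      = (((𝔼 x ∈ Fintype.piFinset fun j : I × Fin 2 => D j.1,
            weight ν ((S₀ ∪ S₁) ∪ flipEdges Tᶜ S₁) x) -
          (𝔼 x ∈ Fintype.piFinset fun j : I × Fin 2 => D j.1, weight ν (S₀ ∪ S₁) x) -
          (𝔼 x ∈ Fintype.piFinset fun j : I × Fin 2 => D j.1,
            weight ν (S₀ ∪ flipEdges Tᶜ S₁) x) +
          𝔼 x ∈ Fintype.piFinset fun j : I × Fin 2 => D j.1, weight ν S₀ x : ℝ) : ℂ) := by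
    rw [← expect_sub_distrib, ← expect_sub_distrib, ← expect_add_distrib, ofReal_expect]
    refine expect_congr rfl fun x _ => ?_
    rw [weight_union ν (disjoint_union_left.2 ⟨hd₂, hd₃⟩), weight_union ν hd₁,
      weight_union ν hd₂, weight_dup ν (fun z hz => hvert z (mem_filter.1 hz).1)]
    simp only [map_sub, map_one, Complex.conj_ofReal]
    push_cast
    ring
  rw [e1]
  refine h.trans ?_
  have b0 := abs_le.1 (hc S₀ hE₀)
  have b1 := abs_le.1 (hc (S₀ ∪ S₁) fun z hz => (mem_union.1 hz).elim (hE₀ z) (hE₁ z))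
  have b2 := abs_le.1 (hc (S₀ ∪ flipEdges Tᶜ S₁) fun z hz =>
    (mem_union.1 hz).elim (hE₀ z) (hE₂ z))
  have b3 := abs_le.1 (hc ((S₀ ∪ S₁) ∪ flipEdges Tᶜ S₁) fun z hz =>
    (mem_union.1 hz).elim (fun hz => (mem_union.1 hz).elim (hE₀ z) (hE₁ z)) (hE₂ z))
  rw [e2, Complex.norm_real, Real.norm_eq_abs]
  refine mul_le_mul_of_nonneg_left ?_ (by linarith)
  rw [abs_le]
  constructor <;> linarith

end VonNeumann
-- The threefold Cauchy–Schwarz argument.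
section VonNeumannInequality

open ComplexConjugate

variable {I X : Type*} [Fintype I] [DecidableEq I] {ν : I × I → X → X → ℝ}
  {D : I → Finset X} {E : Finset (I × I)} {δ : ℝ}

/-- The product of `G` and its conjugate at the point with the vertex `a` replaced by its copy. -/
noncomputable def dupMul (a : I) (G : (I × Fin 2 → X) → ℂ) (x : I × Fin 2 → X) : ℂ :=
  G x * conj (G (dup {a} x))

theorem norm_dupMul_le {G : (I × Fin 2 → X) → ℂ} (h : ∀ x, ‖G x‖ ≤ 1) (a : I)
    (x : I × Fin 2 → X) : ‖dupMul a G x‖ ≤ 1 := by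
  rw [dupMul, norm_mul, RCLike.norm_conj]
  exact mul_le_one₀ (h x) (norm_nonneg _) (h _)

theorem dependsOn_dupMul {G : (I × Fin 2 → X) → ℂ} {s s' : Set (I × Fin 2)} (a : I)
    (h : DependsOn G s) (hs : s ⊆ s') (ha : (a, 0) ∈ s → (a, 1) ∈ s') :
    DependsOn (dupMul a G) s' := by
  intro x y hxy
  have h1 : G x = G y := h fun z hz => hxy z (hs hz)
  have h2 : G (dup {a} x) = G (dup {a} y) := h fun z hz => by
    obtain ⟨i, b⟩ := z
    by_cases hi : i = a ∧ b = 0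
    · obtain ⟨rfl, rfl⟩ := hi
      simpa [dup, flipCopy] using hxy _ (ha hz)
    · simpa [dup, hi] using hxy _ (hs hz)
  rw [dupMul, dupMul, h1, h2]

theorem pow_eight_le {a b c d r : ℝ} (hr : 0 ≤ r) (ha : 0 ≤ a) (hb : 0 ≤ b) (hc : 0 ≤ c)
    (h₁ : a ^ 2 ≤ r * b) (h₂ : b ^ 2 ≤ r * c) (h₃ : c ^ 2 ≤ r * d) : a ^ 8 ≤ r ^ 7 * d := by
  calc a ^ 8 = (a ^ 2) ^ 4 := by ring
    _ ≤ (r * b) ^ 4 := pow_le_pow_left₀ (by positivity) h₁ 4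
    _ = r ^ 4 * (b ^ 2) ^ 2 := by ring
    _ ≤ r ^ 4 * (r * c) ^ 2 := by gcongr
    _ = r ^ 6 * c ^ 2 := by ring
    _ ≤ r ^ 6 * (r * d) := by gcongr
    _ = r ^ 7 * d := by ring

/-- Doubling `k`, `j`, `i` in this order removes `g₁`, then the doubled `g₂`, then the twice doubled
`g₃`, each independent of the vertex about to be doubled. Only the eight copies of `F` survive. The
weights leaving `{i, j, k}` are then dropped, at the cost of the square root term. -/
theorem norm_expect_weight_pow_eight_le (hν : ∀ e x y, 0 ≤ ν e x y) (hE : ∀ i, (i, i) ∉ E)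
    (hδ₀ : 0 ≤ δ)
    (hc : ∀ S : Finset ((I × Fin 2) × (I × Fin 2)), (∀ z ∈ S, (z.1.1, z.2.1) ∈ E) →
      |(𝔼 x ∈ Fintype.piFinset fun j : I × Fin 2 => D j.1, weight ν S x) - 1| ≤ δ)
    {i j k : I} (hij : i ≠ j) (hik : i ≠ k) (hjk : j ≠ k) {F g₁ g₂ g₃ : (I × Fin 2 → X) → ℂ}
    (hF : DependsOn F {(i, 0), (j, 0), (k, 0)}) (hF₁ : ∀ x, ‖F x‖ ≤ 1)
    (h₁ : DependsOn g₁ {z | z.2 = 0 ∧ z.1 ≠ k}) (h₁' : ∀ x, ‖g₁ x‖ ≤ 1)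
    (h₂ : DependsOn g₂ {z | z.2 = 0 ∧ z.1 ≠ j}) (h₂' : ∀ x, ‖g₂ x‖ ≤ 1)
    (h₃ : DependsOn g₃ {z | z.2 = 0 ∧ z.1 ≠ i}) (h₃' : ∀ x, ‖g₃ x‖ ≤ 1) :
    ‖𝔼 x ∈ Fintype.piFinset fun j : I × Fin 2 => D j.1,
        (weight ν (doubledEdges E ∅) x : ℂ) * (g₁ x * (F x * (g₂ x * g₃ x)))‖ ^ 8 ≤
      (1 + δ) ^ 7 * (‖𝔼 x ∈ Fintype.piFinset fun j : I × Fin 2 => D j.1,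
        (weight ν ((doubledEdges E {i, j, k}).filter fun z =>
            z.1.1 ∈ ({i, j, k} : Finset I) ∧ z.2.1 ∈ ({i, j, k} : Finset I)) x : ℂ) *
          dupMul i (dupMul j (dupMul k F)) x‖ + √((1 + δ) * (4 * δ))) := by
  set Ω := Fintype.piFinset fun j : I × Fin 2 => D j.1
  have hmul : ∀ {G H : (I × Fin 2 → X) → ℂ} {s : Set (I × Fin 2)}, DependsOn G s →
      DependsOn H s → DependsOn (fun x => G x * H x) s := by
    intro G H s hG hH x y hxy
    simp only [hG hxy, hH hxy]
  have hFk : DependsOn (dupMul k F) {(i, 0), (j, 0), (k, 0), (k, 1)} :=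
    dependsOn_dupMul k hF (by simp [Set.insert_subset_iff]) (by simp)
  have hFj : DependsOn (dupMul j (dupMul k F)) {(i, 0), (j, 0), (j, 1), (k, 0), (k, 1)} :=
    dependsOn_dupMul j hFk (by simp [Set.insert_subset_iff]) (by simp)
  have hFi : DependsOn (dupMul i (dupMul j (dupMul k F))) {z | z.1 ∈ ({i, j, k} : Finset I)} :=
    dependsOn_dupMul i hFj (by simp [Set.insert_subset_iff]) (by simp)
  have h₂k : DependsOn (dupMul k g₂) {z | z.1 ≠ j} :=
    dependsOn_dupMul k h₂ (fun z hz => hz.2) (by simp [Ne.symm hjk])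
  have h₃k : DependsOn (dupMul k g₃) {z | (z.2 = 0 ∨ z.1 = k) ∧ z.1 ≠ i} :=
    dependsOn_dupMul k h₃ (fun z hz => ⟨Or.inl hz.1, hz.2⟩) (by simp [Ne.symm hik])
  have h₃j : DependsOn (dupMul j (dupMul k g₃)) {z | z.1 ≠ i} :=
    dependsOn_dupMul j h₃k (fun z hz => hz.2) (by simp [Ne.symm hij])
  have s1 := norm_sq_expect_doubledEdges_le ν (D := D) hν hE hc (T := ∅) (a := k) (by simp) g₁
    (fun x => F x * (g₂ x * g₃ x)) h₁' (h₁.mono fun z hz => hz.2)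
    (hmul (hF.mono (by simp [Set.insert_subset_iff])) (hmul (h₂.mono (by
      rintro z hz h; simp [h] at hz)) (h₃.mono (by rintro z hz h; simp [h] at hz))))
  have e1 : ∀ x, (F x * (g₂ x * g₃ x)) * conj (F (dup {k} x) * (g₂ (dup {k} x) * g₃ (dup {k} x)))
      = dupMul k g₂ x * (dupMul k F x * dupMul k g₃ x) := by
    intro x
    simp only [dupMul, map_mul]
    ring
  simp only [e1] at s1
  have s2 := norm_sq_expect_doubledEdges_le ν (D := D) hν hE hc (T := insert k ∅) (a := j)
    (by simpa using hjk) (dupMul k g₂) (fun x => dupMul k F x * dupMul k g₃ x)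
    (norm_dupMul_le h₂' k) h₂k
    (hmul (hFk.mono (by simp [Set.insert_subset_iff, hij, Ne.symm hjk])) (h₃k.mono (by
      rintro z hz h; simp [h] at hz; exact hjk hz.1)))
  have e2 : ∀ x, (dupMul k F x * dupMul k g₃ x) *
        conj (dupMul k F (dup {j} x) * dupMul k g₃ (dup {j} x))
      = dupMul j (dupMul k g₃) x * dupMul j (dupMul k F) x := by
    intro x
    simp only [dupMul, map_mul]
    ring
  simp only [e2] at s2
  have s3 := norm_sq_expect_doubledEdges_le ν (D := D) hν hE hc (T := insert j (insert k ∅))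
    (a := i) (by simp [hij, hik]) (dupMul j (dupMul k g₃)) (dupMul j (dupMul k F))
    (norm_dupMul_le (norm_dupMul_le h₃' k) j) h₃j
    (hFj.mono (by simp [Set.insert_subset_iff, Ne.symm hij, Ne.symm hik]))
  have s4 := norm_sq_expect_doubledEdges_sub_le ν (D := D) hν hc {i, j, k}
    (dupMul i (dupMul j (dupMul k F))) (norm_dupMul_le (norm_dupMul_le (norm_dupMul_le hF₁ k) j) i)
    hFi
  have s5 := Real.le_sqrt_of_sq_le s4
  have hset : insert i (insert j (insert k (∅ : Finset I))) = {i, j, k} := rfl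
  rw [hset] at s3
  have s6 := (norm_le_norm_add_norm_sub' _ _).trans (add_le_add_right s5 _)
  have hδ1 : 0 ≤ 1 + δ := by linarith
  exact (pow_eight_le hδ1 (norm_nonneg _) (norm_nonneg _) (norm_nonneg _) s1 s2 s3).trans
    (mul_le_mul_of_nonneg_left s6 (by positivity))

end VonNeumannInequality
-- Splitting averages and identifying the surviving weights.
section Marginals

variable {X : Type*}

theorem expect_piFinset_sum {α β : Type*} [Fintype α] [Fintype β] [DecidableEq α] [DecidableEq β]
    (D : α ⊕ β → Finset X) (f : (α ⊕ β → X) → ℂ) :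
    𝔼 x ∈ Fintype.piFinset D, f x = 𝔼 y ∈ Fintype.piFinset fun a => D (Sum.inl a),
      𝔼 z ∈ Fintype.piFinset fun b => D (Sum.inr b), f (Sum.elim y z) := by
  rw [← expect_product']
  refine expect_nbij' (fun x => (x ∘ Sum.inl, x ∘ Sum.inr)) (fun z => Sum.elim z.1 z.2)
    ?_ ?_ ?_ ?_ ?_
  · intro x hx
    rw [Fintype.mem_piFinset] at hx
    exact mem_product.2 ⟨Fintype.mem_piFinset.2 fun a => hx _, Fintype.mem_piFinset.2 fun b => hx _⟩
  · intro z hz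
    rw [mem_product, Fintype.mem_piFinset, Fintype.mem_piFinset] at hz
    exact Fintype.mem_piFinset.2 (Sum.rec hz.1 hz.2)
  · intro x _
    exact Sum.elim_comp_inl_inr x
  · intro z _
    rfl
  · intro x _
    exact congrArg f (Sum.elim_comp_inl_inr x).symm

variable {I : Type*} [Fintype I] [DecidableEq I] {ν : I × I → X → X → ℝ}

theorem weight_doubledEdges_empty (E : Finset (I × I)) (x : I × Fin 2 → X) :
    weight ν (doubledEdges E ∅) x = ∏ z ∈ E, ν z (x (z.1, 0)) (x (z.2, 0)) := by
  refine prod_nbij' (fun z => (z.1.1, z.2.1)) (fun z => ((z.1, 0), (z.2, 0))) ?_ ?_ ?_ ?_ ?_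
  · intro z hz
    exact (mem_doubledEdges.1 hz).1
  · intro z hz
    simpa [mem_doubledEdges] using hz
  · rintro ⟨⟨i, b⟩, ⟨j, c⟩⟩ hz
    simp only [mem_doubledEdges, notMem_empty, not_false_eq_true, true_imp_iff] at hz
    simp [hz.2]
  · intro z _
    rfl
  · rintro ⟨⟨i, b⟩, ⟨j, c⟩⟩ hz
    simp only [mem_doubledEdges, notMem_empty, not_false_eq_true, true_imp_iff] at hz
    simp [hz.2]

/-- Doubling every vertex of a triangle gives the twelve edges of an octahedron, exactly the weights
in the local `U³` norm. -/
theorem weight_doubledEdges_triangle {E : Finset (I × I)} {i j k : I} (hij : i ≠ j) (hjk : j ≠ k)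
    (hE : ∀ z, z.1 ∈ ({i, j, k} : Finset I) → z.2 ∈ ({i, j, k} : Finset I) →
      (z ∈ E ↔ z = (i, j) ∨ z = (i, k) ∨ z = (j, k))) (x : I × Fin 2 → X) :
    weight ν ((doubledEdges E {i, j, k}).filter fun z =>
        z.1.1 ∈ ({i, j, k} : Finset I) ∧ z.2.1 ∈ ({i, j, k} : Finset I)) x =
      (∏ a, ∏ b, ν (i, j) (x (i, a)) (x (j, b))) * (∏ a, ∏ b, ν (i, k) (x (i, a)) (x (k, b))) *
        ∏ a, ∏ b, ν (j, k) (x (j, a)) (x (k, b)) := by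
  have h : weight ν ((doubledEdges E {i, j, k}).filter fun z =>
        z.1.1 ∈ ({i, j, k} : Finset I) ∧ z.2.1 ∈ ({i, j, k} : Finset I)) x =
      ∏ z ∈ ({(i, j), (i, k), (j, k)} : Finset (I × I)) ×ˢ (univ : Finset (Fin 2 × Fin 2)),
        ν z.1 (x (z.1.1, z.2.1)) (x (z.1.2, z.2.2)) := by
    refine prod_nbij' (fun z => ((z.1.1, z.2.1), (z.1.2, z.2.2)))
      (fun z => ((z.1.1, z.2.1), (z.1.2, z.2.2))) ?_ ?_ (fun _ _ => rfl) (fun _ _ => rfl)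
      (fun _ _ => rfl)
    · intro z hz
      rw [mem_filter, mem_doubledEdges] at hz
      have := (hE _ hz.2.1 hz.2.2).1 hz.1.1
      simpa using this
    · intro z hz
      simp only [mem_product, mem_univ, and_true, mem_insert, mem_singleton] at hz
      have h1 : z.1.1 ∈ ({i, j, k} : Finset I) := by rcases hz with h | h | h <;> simp [h]
      have h2 : z.1.2 ∈ ({i, j, k} : Finset I) := by rcases hz with h | h | h <;> simp [h]
      exact mem_filter.2 ⟨mem_doubledEdges.2 ⟨(hE _ h1 h2).2 hz, fun h => absurd h1 h,
        fun h => absurd h2 h⟩, h1, h2⟩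
  rw [h, prod_product, prod_insert (by simp [hij, hjk]), prod_insert (by simp [hij]),
    prod_singleton, ← mul_assoc]
  simp only [Fintype.prod_prod_type]

end Marginals

theorem injective_copies {I : Type*} {i j k : I} (hij : i ≠ j) (hik : i ≠ k) (hjk : j ≠ k) :
    Function.Injective (Sum.elim (fun b => (i, b)) (Sum.elim (fun b => (j, b)) fun b => (k, b)) :
      Fin 2 ⊕ Fin 2 ⊕ Fin 2 → I × Fin 2) := by
  rintro (a | a | a) (b | b | b) h
  all_goals simp only [Sum.elim_inl, Sum.elim_inr, Prod.mk.injEq, hij, hij.symm, hik, hik.symm, hjk,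
    hjk.symm, false_and, true_and] at h
  all_goals rw [h]

/-! ### The ternary operator as a weighted graph average, and its control by the local norm. -/

section Operators

set_option linter.unusedSectionVars false

variable {p n l q : ℕ} [Fact p.Prime] {U V W : Type} [Fintype U] [Fintype V] [Fintype W]
  [DecidableEq U] [DecidableEq V] [DecidableEq W]

/-- The label of the atom of a vertex. -/
def LabelFamily.vertex (e : LabelFamily p l q U V W) : U ⊕ V ⊕ W → AtomLabel p l q :=
  Sum.elim e.a (Sum.elim e.b e.c)

/-- The label of the bilinear level set of a pair of vertices from different classes. -/
def LabelFamily.pair (e : LabelFamily p l q U V W) : (U ⊕ V ⊕ W) × (U ⊕ V ⊕ W) → Fin q → ZMod p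
  | (Sum.inl u, Sum.inr (Sum.inl v)) => e.dUV u v
  | (Sum.inl u, Sum.inr (Sum.inr w)) => e.dUW u w
  | (Sum.inr (Sum.inl v), Sum.inr (Sum.inr w)) => e.dVW v w
  -- A filler value: products of weights run over crossing pairs only.
  | _ => 0

/-- A pair of vertices from different classes, in the order of the classes. -/
def crossing : (U ⊕ V ⊕ W) × (U ⊕ V ⊕ W) → Bool
  | (Sum.inl _, Sum.inr _) => true
  | (Sum.inr (Sum.inl _), Sum.inr (Sum.inr _)) => true
  | _ => false

/-- The pairs of vertices from different classes, in the order of the classes. -/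
def crossingPairs (U V W : Type) [Fintype U] [Fintype V] [Fintype W] :
    Finset ((U ⊕ V ⊕ W) × (U ⊕ V ⊕ W)) :=
  univ.filter fun z => crossing z = true

theorem mem_crossingPairs {z : (U ⊕ V ⊕ W) × (U ⊕ V ⊕ W)} :
    z ∈ crossingPairs U V W ↔ crossing z = true := by
  rw [crossingPairs, mem_filter]
  exact and_iff_right (mem_univ z)

theorem prod_crossingPairs {M : Type*} [CommMonoid M] (g : (U ⊕ V ⊕ W) × (U ⊕ V ⊕ W) → M) :
    ∏ z ∈ crossingPairs U V W, g z =
      (∏ u, ∏ v, g (Sum.inl u, Sum.inr (Sum.inl v))) *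
      (∏ u, ∏ w, g (Sum.inl u, Sum.inr (Sum.inr w))) *
      ∏ v, ∏ w, g (Sum.inr (Sum.inl v), Sum.inr (Sum.inr w)) := by
  rw [crossingPairs, prod_filter, Fintype.prod_prod_type]
  simp [Fintype.prod_sum_type, crossing, prod_mul_distrib, mul_assoc]

theorem ternaryOp_eq (B : QuadraticFactor p n l q) (e : LabelFamily p l q U V W)
    (f : U → V → W → Vec p n → ℂ) :
    ternaryOp B e f = 𝔼 x ∈ Fintype.piFinset fun i => B.atom (e.vertex i),
      ((∏ z ∈ crossingPairs U V W, B.mu (e.pair z) (x z.1) (x z.2) : ℝ) : ℂ) *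
        ∏ u, ∏ v, ∏ w, f u v w (x (Sum.inl u) + x (Sum.inr (Sum.inl v)) + x (Sum.inr (Sum.inr w))) := by
  rw [expect_piFinset_sum, ternaryOp]
  refine expect_congr rfl fun x _ => ?_
  rw [expect_piFinset_sum]
  refine expect_congr rfl fun y _ => expect_congr rfl fun z _ => ?_
  rw [prod_crossingPairs]
  push_cast
  rfl

theorem localU3Inner_eq (B : QuadraticFactor p n l q) (d : SixLabel p l q) (f : Vec p n → ℂ) :
    B.localU3Inner d (fun _ => f) =
      𝔼 x ∈ Fintype.piFinset (Sum.elim (fun _ : Fin 2 => B.atom d.a₁)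
          (Sum.elim (fun _ : Fin 2 => B.atom d.a₂) fun _ : Fin 2 => B.atom d.a₃)),
        (((∏ i, ∏ j, B.mu d.b₁₂ (x (Sum.inl i)) (x (Sum.inr (Sum.inl j)))) *
          (∏ i, ∏ k, B.mu d.b₁₃ (x (Sum.inl i)) (x (Sum.inr (Sum.inr k)))) *
          ∏ j, ∏ k, B.mu d.b₂₃ (x (Sum.inr (Sum.inl j))) (x (Sum.inr (Sum.inr k))) : ℝ) : ℂ) *
        ∏ ω : Fin 2 × Fin 2 × Fin 2, (starRingEnd ℂ)^[(ω.1 : ℕ) + (ω.2.1 : ℕ) + (ω.2.2 : ℕ)]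
          (f (x (Sum.inl ω.1) + x (Sum.inr (Sum.inl ω.2.1)) + x (Sum.inr (Sum.inr ω.2.2)))) := by
  rw [expect_piFinset_sum, QuadraticFactor.localU3Inner]
  refine expect_congr rfl fun x _ => ?_
  rw [expect_piFinset_sum]
  refine expect_congr rfl fun y _ => expect_congr rfl fun z _ => ?_
  push_cast
  rfl

theorem dupMul_triple {I : Type*} [Fintype I] [DecidableEq I] {X : Type*} [Add X] {i j k : I}
    (hij : i ≠ j) (hik : i ≠ k) (hjk : j ≠ k) (f : X → ℂ) (x : I × Fin 2 → X) :
    dupMul i (dupMul j (dupMul k fun x => f (x (i, 0) + x (j, 0) + x (k, 0)))) x =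
      ∏ ω : Fin 2 × Fin 2 × Fin 2, (starRingEnd ℂ)^[(ω.1 : ℕ) + (ω.2.1 : ℕ) + (ω.2.2 : ℕ)]
          (f (x (i, ω.1) + x (j, ω.2.1) + x (k, ω.2.2))) := by
  simp only [dupMul, dup, flipCopy, Fintype.prod_prod_type, Fin.prod_univ_two, Fin.val_zero,
    Fin.val_one, Function.iterate_succ, Function.iterate_zero, Function.comp, id, map_mul,
    Complex.conj_conj, add_zero, mem_filter, mem_univ, true_and, mem_singleton, piecewise,
    hij, hik, hjk, hij.symm, hik.symm, hjk.symm, and_true, if_true, if_false, zero_add,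
    false_and, one_ne_zero]

/-- Joint quasirandomness of the weights of a factor: all averages of products of at most `K`
weights over at most `K` variables in atoms are within `δ` of `1`. -/
def QuadraticFactor.IsQuasirandom (B : QuadraticFactor p n l q) (K : ℕ) (δ : ℝ) : Prop :=
  ∀ (J : Type) [Fintype J] [DecidableEq J] (a : J → AtomLabel p l q) (S : Finset (J × J))
    (d : J × J → Fin q → ZMod p), (∀ z ∈ S, z.swap ∉ S) → Fintype.card J + S.card ≤ K →
    |(𝔼 x ∈ Fintype.piFinset fun j => B.atom (a j), ∏ z ∈ S, B.mu (d z) (x z.1) (x z.2)) - 1| ≤ δ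

/-- Over an empty atom the average of the empty product would be 0 instead of nearly 1. -/
theorem QuadraticFactor.IsQuasirandom.atom_nonempty {B : QuadraticFactor p n l q} {K : ℕ} {δ : ℝ}
    (hB : B.IsQuasirandom K δ) (hK : 1 ≤ K) (hδ : δ < 1) (a : AtomLabel p l q) :
    (B.atom a).Nonempty := by
  by_contra h
  rw [not_nonempty_iff_eq_empty] at h
  have h1 := hB Unit (fun _ => a) ∅ (fun _ => 0) (by simp) (by simpa using hK)
  have h2 : (Fintype.piFinset fun _ : Unit => (∅ : Finset (Vec p n))) = ∅ := by
    rw [← not_nonempty_iff_eq_empty, Fintype.piFinset_nonempty]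
    simp
  simp only [h, h2, expect_empty, zero_sub, abs_neg, abs_one] at h1
  linarith

theorem crossingPairs_swap {z : (U ⊕ V ⊕ W) × (U ⊕ V ⊕ W)} (hz : z ∈ crossingPairs U V W) :
    z.swap ∉ crossingPairs U V W := by
  rw [mem_crossingPairs] at hz ⊢
  obtain ⟨u | v | w, u' | v' | w'⟩ := z <;> simp_all [crossing]

theorem mem_crossingPairs_triangle {u : U} {v : V} {w : W} {z : (U ⊕ V ⊕ W) × (U ⊕ V ⊕ W)}
    (h₁ : z.1 ∈ ({Sum.inl u, Sum.inr (Sum.inl v), Sum.inr (Sum.inr w)} : Finset (U ⊕ V ⊕ W)))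
    (h₂ : z.2 ∈ ({Sum.inl u, Sum.inr (Sum.inl v), Sum.inr (Sum.inr w)} : Finset (U ⊕ V ⊕ W))) :
    z ∈ crossingPairs U V W ↔ z = (Sum.inl u, Sum.inr (Sum.inl v)) ∨
      z = (Sum.inl u, Sum.inr (Sum.inr w)) ∨ z = (Sum.inr (Sum.inl v), Sum.inr (Sum.inr w)) := by
  obtain ⟨a, b⟩ := z
  simp only [mem_insert, mem_singleton] at h₁ h₂
  rw [mem_crossingPairs]
  rcases h₁ with rfl | rfl | rfl <;> rcases h₂ with rfl | rfl | rfl <;> simp [crossing]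

theorem localU3Norm_nonneg (B : QuadraticFactor p n l q) (d : SixLabel p l q) (f : Vec p n → ℂ) :
    0 ≤ B.localU3Norm d f :=
  Real.rpow_nonneg (Complex.nonneg_iff.1 (B.localU3Inner_self_nonneg d f)).1 _

theorem norm_localU3Inner (B : QuadraticFactor p n l q) (d : SixLabel p l q) (f : Vec p n → ℂ) :
    ‖B.localU3Inner d fun _ => f‖ = B.localU3Norm d f ^ 8 := by
  have h := Complex.nonneg_iff.1 (B.localU3Inner_self_nonneg d f)
  rw [QuadraticFactor.localU3Norm, ← Real.rpow_natCast, ← Real.rpow_mul h.1]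
  norm_num
  rw [← Complex.re_eq_norm.2 (B.localU3Inner_self_nonneg d f)]

/-- The generalized von Neumann inequality for the ternary operator. -/
theorem norm_ternaryOp_pow_eight_le {B : QuadraticFactor p n l q} {K : ℕ} {δ : ℝ}
    (hB : B.IsQuasirandom K δ) (hδ₀ : 0 ≤ δ) (hδ : δ < 1)
    (hK : 2 * Fintype.card (U ⊕ V ⊕ W) + (2 * Fintype.card (U ⊕ V ⊕ W)) ^ 2 ≤ K)
    (e : LabelFamily p l q U V W) (f : U → V → W → Vec p n → ℂ) (hf : ∀ u v w y, ‖f u v w y‖ ≤ 1)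
    (u₀ : U) (v₀ : V) (w₀ : W) :
    ‖ternaryOp B e f‖ ^ 8 ≤ (1 + δ) ^ 7 *
      (B.localU3Norm (e.tuple u₀ v₀ w₀) (f u₀ v₀ w₀) ^ 8 + √((1 + δ) * (4 * δ))) := by
  have hK₁ : 1 ≤ K := by
    have : 0 < Fintype.card (U ⊕ V ⊕ W) := Fintype.card_pos_iff.2 ⟨Sum.inl u₀⟩
    omega
  have hne := fun a => hB.atom_nonempty hK₁ hδ a
  set D : U ⊕ V ⊕ W → Finset (Vec p n) := fun i => B.atom (e.vertex i) with hD
  set ν : (U ⊕ V ⊕ W) × (U ⊕ V ⊕ W) → Vec p n → Vec p n → ℝ := fun z x y =>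
    B.mu (e.pair z) x y with hν
  set i : U ⊕ V ⊕ W := Sum.inl u₀ with hi
  set j : U ⊕ V ⊕ W := Sum.inr (Sum.inl v₀) with hj
  set k : U ⊕ V ⊕ W := Sum.inr (Sum.inr w₀) with hk
  have hij : i ≠ j := by simp [hi, hj]
  have hik : i ≠ k := by simp [hi, hk]
  have hjk : j ≠ k := by simp [hj, hk]
  have hc : ∀ S : Finset (((U ⊕ V ⊕ W) × Fin 2) × ((U ⊕ V ⊕ W) × Fin 2)),
      (∀ z ∈ S, (z.1.1, z.2.1) ∈ crossingPairs U V W) →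
      |(𝔼 x ∈ Fintype.piFinset fun j : (U ⊕ V ⊕ W) × Fin 2 => D j.1, weight ν S x) - 1| ≤ δ := by
    intro S hS
    refine hB ((U ⊕ V ⊕ W) × Fin 2) (fun j => e.vertex j.1) S (fun z => e.pair (z.1.1, z.2.1))
      (fun z hz hz' => crossingPairs_swap (hS z hz) (hS _ hz')) (le_trans ?_ hK)
    -- The doubled graph has twice as many vertices, and its edges are among all ordered pairs of
    -- them; this is the origin of the bound in `hK`.
    have h1 : S.card ≤ Fintype.card (((U ⊕ V ⊕ W) × Fin 2) × ((U ⊕ V ⊕ W) × Fin 2)) :=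
      card_le_univ S
    rw [Fintype.card_prod] at h1
    have h2 : Fintype.card ((U ⊕ V ⊕ W) × Fin 2) = 2 * Fintype.card (U ⊕ V ⊕ W) := by
      rw [Fintype.card_prod, Fintype.card_fin, mul_comm]
    rw [h2] at h1 ⊢
    rw [sq]
    omega
  let g : U × V × W → ((U ⊕ V ⊕ W) × Fin 2 → Vec p n) → ℂ := fun t x =>
    f t.1 t.2.1 t.2.2 (x (Sum.inl t.1, 0) + x (Sum.inr (Sum.inl t.2.1), 0) +
      x (Sum.inr (Sum.inr t.2.2), 0))
  have hg : ∀ t, DependsOn (g t)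
      {(Sum.inl t.1, 0), (Sum.inr (Sum.inl t.2.1), 0), (Sum.inr (Sum.inr t.2.2), 0)} := by
    intro t x y hxy
    simp only [g]
    rw [hxy _ (by simp), hxy _ (by simp), hxy _ (by simp)]
  have hprod : ∀ (s : Finset (U × V × W)) (r : Set ((U ⊕ V ⊕ W) × Fin 2)),
      (∀ t ∈ s, ({(Sum.inl t.1, 0), (Sum.inr (Sum.inl t.2.1), 0), (Sum.inr (Sum.inr t.2.2), 0)} :
        Set ((U ⊕ V ⊕ W) × Fin 2)) ⊆ r) → DependsOn (fun x => ∏ t ∈ s, g t x) r := by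
    intro s r h x y hxy
    exact prod_congr rfl fun t ht => ((hg t).mono (h t ht)) hxy
  have hprod₁ : ∀ (s : Finset (U × V × W)) x, ‖∏ t ∈ s, g t x‖ ≤ 1 := by
    intro s x
    rw [norm_prod]
    exact prod_le_one (fun _ _ => norm_nonneg _) fun _ _ => hf _ _ _ _
  have key := norm_expect_weight_pow_eight_le (ν := ν) (D := D) (E := crossingPairs U V W)
    (fun _ _ _ => B.mu_nonneg _ _ _) (fun i hi => crossingPairs_swap hi hi) hδ₀ hc hij hik hjk
    (F := g (u₀, v₀, w₀))
    -- The other triples are sorted by the first coordinate in which they differ from `(u₀, v₀,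
    -- w₀)`; each class avoids the corresponding vertex.
    (g₁ := fun x => ∏ t ∈ univ.filter fun t => t.1 = u₀ ∧ t.2.1 = v₀ ∧ t.2.2 ≠ w₀, g t x)
    (g₂ := fun x => ∏ t ∈ univ.filter fun t => t.1 = u₀ ∧ t.2.1 ≠ v₀, g t x)
    (g₃ := fun x => ∏ t ∈ univ.filter fun t => t.1 ≠ u₀, g t x)
    (hg _) (fun x => hf _ _ _ _)
    (hprod _ _ fun t ht => by
      simp only [mem_filter, mem_univ, true_and] at ht
      simp [Set.insert_subset_iff, hk, ht])
    (hprod₁ _)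
    (hprod _ _ fun t ht => by
      simp only [mem_filter, mem_univ, true_and] at ht
      simp [Set.insert_subset_iff, hj, ht])
    (hprod₁ _)
    (hprod _ _ fun t ht => by
      simp only [mem_filter, mem_univ, true_and] at ht
      simp [Set.insert_subset_iff, hi, ht])
    (hprod₁ _)
  have hsplit : ∀ x, (∏ t ∈ univ.filter fun t => t.1 = u₀ ∧ t.2.1 = v₀ ∧ t.2.2 ≠ w₀, g t x) *
      (g (u₀, v₀, w₀) x * ((∏ t ∈ univ.filter fun t => t.1 = u₀ ∧ t.2.1 ≠ v₀, g t x) *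
        ∏ t ∈ univ.filter fun t => t.1 ≠ u₀, g t x)) = ∏ u, ∏ v, ∏ w, g (u, v, w) x := by
    intro x
    simp only [← Fintype.prod_prod_type' (f := fun v w => g (_, v, w) x)]
    rw [← Fintype.prod_prod_type' (f := fun u (z : V × W) => g (u, z.1, z.2) x)]
    rw [← prod_filter_mul_prod_filter_not univ (fun t : U × V × W => t.1 = u₀),
      ← prod_filter_mul_prod_filter_not (univ.filter fun t : U × V × W => t.1 = u₀)
        (fun t => t.2.1 = v₀),
      ← prod_filter_mul_prod_filter_not ((univ.filter fun t : U × V × W => t.1 = u₀).filter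
        fun t => t.2.1 = v₀) (fun t => t.2.2 = w₀)]
    simp only [filter_filter]
    have h1 : (univ.filter fun t : U × V × W => (t.1 = u₀ ∧ t.2.1 = v₀) ∧ t.2.2 = w₀)
        = {(u₀, v₀, w₀)} := by
      ext ⟨u, v, w⟩
      simp [and_assoc]
    rw [h1, prod_singleton]
    simp only [and_assoc]
    ring
  simp only [hsplit] at key
  have hleft : ternaryOp B e f = 𝔼 x ∈ Fintype.piFinset fun j : (U ⊕ V ⊕ W) × Fin 2 => D j.1,
      (weight ν (doubledEdges (crossingPairs U V W) ∅) x : ℂ) *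
        ∏ u, ∏ v, ∏ w, g (u, v, w) x := by
    rw [ternaryOp_eq]
    have h1 := expect_comp_injective (fun j : (U ⊕ V ⊕ W) × Fin 2 => D j.1) (fun j => hne _)
      (i := fun i : U ⊕ V ⊕ W => (i, (0 : Fin 2))) (fun a b h => congrArg Prod.fst h)
      (fun x => ((∏ z ∈ crossingPairs U V W, B.mu (e.pair z) (x z.1) (x z.2) : ℝ) : ℂ) *
        ∏ u, ∏ v, ∏ w, f u v w (x (Sum.inl u) + x (Sum.inr (Sum.inl v)) + x (Sum.inr (Sum.inr w))))
    refine h1.symm.trans (expect_congr rfl fun x _ => ?_)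
    rw [weight_doubledEdges_empty]
    rfl
  have hright : (𝔼 x ∈ Fintype.piFinset fun j : (U ⊕ V ⊕ W) × Fin 2 => D j.1,
        (weight ν ((doubledEdges (crossingPairs U V W) {i, j, k}).filter fun z =>
            z.1.1 ∈ ({i, j, k} : Finset _) ∧ z.2.1 ∈ ({i, j, k} : Finset _)) x : ℂ) *
          dupMul i (dupMul j (dupMul k (g (u₀, v₀, w₀)))) x)
      = B.localU3Inner (e.tuple u₀ v₀ w₀) fun _ => f u₀ v₀ w₀ := by
    rw [localU3Inner_eq]
    have h1 := expect_comp_injective (fun j : (U ⊕ V ⊕ W) × Fin 2 => D j.1) (fun j => hne _)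
      (i := (Sum.elim (fun b => (i, b)) (Sum.elim (fun b => (j, b)) fun b => (k, b)) :
        Fin 2 ⊕ Fin 2 ⊕ Fin 2 → (U ⊕ V ⊕ W) × Fin 2)) (injective_copies hij hik hjk)
      (fun x => (((∏ i, ∏ j, B.mu (e.dUV u₀ v₀) (x (Sum.inl i)) (x (Sum.inr (Sum.inl j)))) *
          (∏ i, ∏ k, B.mu (e.dUW u₀ w₀) (x (Sum.inl i)) (x (Sum.inr (Sum.inr k)))) *
          ∏ j, ∏ k, B.mu (e.dVW v₀ w₀) (x (Sum.inr (Sum.inl j))) (x (Sum.inr (Sum.inr k))) : ℝ)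
            : ℂ) *
        ∏ ω : Fin 2 × Fin 2 × Fin 2, (starRingEnd ℂ)^[(ω.1 : ℕ) + (ω.2.1 : ℕ) + (ω.2.2 : ℕ)]
          (f u₀ v₀ w₀ (x (Sum.inl ω.1) + x (Sum.inr (Sum.inl ω.2.1)) +
            x (Sum.inr (Sum.inr ω.2.2)))))
    refine Eq.trans (expect_congr rfl fun x _ => ?_) (h1.trans ?_)
    · rw [weight_doubledEdges_triangle hij hjk]
      · congr 1
        exact dupMul_triple hij hik hjk (f u₀ v₀ w₀) x
      · exact fun z hz₁ hz₂ => mem_crossingPairs_triangle hz₁ hz₂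
    · congr 2
      funext a
      rcases a with a | a | a <;> rfl
  rw [hleft, ← norm_localU3Inner, ← hright]
  exact key

end Operators
-- Telescoping over triples, and the operator as a normalized count.
section Counting

set_option linter.unusedSectionVars false

variable {p n l q : ℕ} [Fact p.Prime] {U V W : Type} [Fintype U] [Fintype V] [Fintype W]
  [DecidableEq U] [DecidableEq V] [DecidableEq W]

theorem ternaryOp_sub {B : QuadraticFactor p n l q} {e : LabelFamily p l q U V W}
    {f g h : U × V × W → Vec p n → ℂ} {t₀ : U × V × W} (hfg : ∀ t ≠ t₀, f t = g t)
    (hfh : ∀ t ≠ t₀, f t = h t) (h₀ : ∀ y, f t₀ y = g t₀ y + h t₀ y) :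
    ternaryOp B e (fun u v w => f (u, v, w)) - ternaryOp B e (fun u v w => g (u, v, w))
      = ternaryOp B e fun u v w => h (u, v, w) := by
  simp only [ternaryOp_eq]
  rw [← expect_sub_distrib]
  refine expect_congr rfl fun x _ => ?_
  rw [← mul_sub]
  congr 1
  let y : U × V × W → Vec p n := fun t =>
    x (Sum.inl t.1) + x (Sum.inr (Sum.inl t.2.1)) + x (Sum.inr (Sum.inr t.2.2))
  have hprod : ∀ f : U × V × W → Vec p n → ℂ, ∏ u, ∏ v, ∏ w, f (u, v, w)
      (x (Sum.inl u) + x (Sum.inr (Sum.inl v)) + x (Sum.inr (Sum.inr w)))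
      = f t₀ (y t₀) * ∏ t ∈ univ.erase t₀, f t (y t) := by
    intro f
    rw [mul_prod_erase univ (fun t => f t (y t)) (mem_univ t₀)]
    simp only [Fintype.prod_prod_type]
    rfl
  rw [hprod, hprod, hprod, h₀,
    prod_congr rfl fun t ht => congrFun (hfg t (ne_of_mem_erase ht)) (y t),
    prod_congr rfl fun t ht => congrFun
      ((hfh t (ne_of_mem_erase ht)).symm.trans (hfg t (ne_of_mem_erase ht))) (y t)]
  ring

/-- Slots are switched from `g` to `f` one at a time, and multilinearity turns each change into an
operator with `± r t₀` in one slot. Both signs are needed because `1_{A^C} - (1 - α) = -(1_A - α)`.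
-/
theorem norm_ternaryOp_sub_le {B : QuadraticFactor p n l q} {e : LabelFamily p l q U V W}
    {f g r : U × V × W → Vec p n → ℂ} {M : ℝ} (hf : ∀ t y, ‖f t y‖ ≤ 1) (hg : ∀ t y, ‖g t y‖ ≤ 1)
    (hr : ∀ t y, ‖r t y‖ ≤ 1)
    (hfgr : ∀ t, (∀ y, f t y = g t y + r t y) ∨ ∀ y, g t y = f t y + r t y)
    (hM : ∀ (h : U × V × W → Vec p n → ℂ) (t₀ : U × V × W), (∀ t y, ‖h t y‖ ≤ 1) → h t₀ = r t₀ →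
      ‖ternaryOp B e fun u v w => h (u, v, w)‖ ≤ M) :
    ‖ternaryOp B e (fun u v w => f (u, v, w)) - ternaryOp B e (fun u v w => g (u, v, w))‖
      ≤ Fintype.card (U × V × W) * M := by
  have key : ∀ s : Finset (U × V × W),
      ‖ternaryOp B e (fun u v w => s.piecewise f g (u, v, w)) -
        ternaryOp B e (fun u v w => g (u, v, w))‖ ≤ s.card * M := by
    intro s
    induction s using Finset.induction_on with
    | empty => simp
    | insert t₀ s hs ih =>
      have hstep : ‖ternaryOp B e (fun u v w => (insert t₀ s).piecewise f g (u, v, w)) -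
          ternaryOp B e (fun u v w => s.piecewise f g (u, v, w))‖ ≤ M := by
        have h1 : ∀ t ≠ t₀, (insert t₀ s).piecewise f g t = s.piecewise f g t := fun t ht => by
          simp [piecewise, ht]
        have h2 : ∀ t ≠ t₀, s.piecewise f g t = Function.update (s.piecewise f g) t₀ (r t₀) t :=
          fun t ht => by simp [ht]
        have h3 : (insert t₀ s).piecewise f g t₀ = f t₀ := by simp
        have h4 : s.piecewise f g t₀ = g t₀ := by simp [hs]
        have h5 : ‖ternaryOp B e fun u v w =>
            Function.update (s.piecewise f g) t₀ (r t₀) (u, v, w)‖ ≤ M := by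
          refine hM _ t₀ (fun t y => ?_) (by simp)
          by_cases ht : t = t₀
          · subst ht
            simpa using hr t y
          · by_cases hts : t ∈ s <;> simp [ht, hts, hf, hg]
        rcases hfgr t₀ with h | h
        · rw [ternaryOp_sub h1 (fun t ht => (h1 t ht).trans (h2 t ht)) (t₀ := t₀)]
          · exact h5
          · intro y
            rw [h3, h4, Function.update_self, h]
        · rw [norm_sub_rev, ternaryOp_sub (fun t ht => (h1 t ht).symm) h2]
          · exact h5
          · intro y
            rw [h3, h4, Function.update_self, h]
      rw [card_insert_of_notMem hs]
      push_cast
      calc _ ≤ _ := norm_sub_le_norm_sub_add_norm_sub _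
            (ternaryOp B e (fun u v w => s.piecewise f g (u, v, w))) _
        _ ≤ M + s.card * M := add_le_add hstep ih
        _ = _ := by ring
  simpa using key univ

theorem ternaryOp_const (B : QuadraticFactor p n l q) (e : LabelFamily p l q U V W)
    (c : U → V → W → ℂ) :
    ternaryOp B e (fun u v w _ => c u v w) =
      (∏ u, ∏ v, ∏ w, c u v w) * ternaryOp B e fun _ _ _ _ => 1 := by
  simp only [ternaryOp_eq, prod_const_one, mul_one]
  rw [← expect_mul, mul_comm]

theorem QuadraticFactor.IsQuasirandom.abs_expect_crossing_le {B : QuadraticFactor p n l q} {K : ℕ}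
    {δ : ℝ} (hB : B.IsQuasirandom K δ)
    (hK : 2 * Fintype.card (U ⊕ V ⊕ W) + (2 * Fintype.card (U ⊕ V ⊕ W)) ^ 2 ≤ K)
    (e : LabelFamily p l q U V W) :
    ‖ternaryOp B e (fun _ _ _ _ => 1) - 1‖ ≤ δ := by
  have h := hB (U ⊕ V ⊕ W) e.vertex (crossingPairs U V W) e.pair (fun _ => crossingPairs_swap) (by
    have h1 : (crossingPairs U V W).card ≤ Fintype.card ((U ⊕ V ⊕ W) × (U ⊕ V ⊕ W)) :=
      card_le_univ _
    rw [Fintype.card_prod] at h1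
    nlinarith)
  simp only [ternaryOp_eq, prod_const_one, mul_one]
  rw [← ofReal_expect, ← Complex.ofReal_one, ← Complex.ofReal_sub, Complex.norm_real]
  exact h

open Classical in
theorem edgeProduct_eq (F : TripartiteHypergraph U V W) (α : U → V → W → ℝ) :
    edgeProduct F α = ∏ u, ∏ v, ∏ w, if F.IsEdge u v w then α u v w else 1 - α u v w := by
  rw [edgeProduct, ← prod_ite]
  simp only [Fintype.prod_prod_type]

/-- The value of a product of weights over all pairs, divided by the number of tuples. -/
noncomputable def weightScale (B : QuadraticFactor p n l q) (e : LabelFamily p l q U V W) : ℝ :=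
  (∏ z ∈ crossingPairs U V W,
      (Fintype.card (Vec p n) : ℝ) ^ 2 / ((B.beta (e.pair z)).card : ℝ)) /
    ((Fintype.piFinset fun i => B.atom (e.vertex i)).card : ℝ)

theorem weightScale_nonneg (B : QuadraticFactor p n l q) (e : LabelFamily p l q U V W) :
    0 ≤ weightScale B e :=
  div_nonneg (prod_nonneg fun _ _ => by positivity) (by positivity)

open Classical in
-- The product of weights is constant on `tupleSet B e` and vanishes on all other tuples from the
-- atoms, so the operator counts tuples up to the scale.
theorem ternaryOp_indicator [Nonempty U] [Nonempty V] [Nonempty W] (B : QuadraticFactor p n l q)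
    (e : LabelFamily p l q U V W) (Q : U → V → W → Vec p n → Prop) :
    ternaryOp B e (fun u v w y => if Q u v w y then 1 else 0) =
      ((weightScale B e * ({t ∈ tupleSet B e | ∀ u v w, Q u v w (t.1 u + t.2.1 v + t.2.2 w)}.ncard : ℝ)
        : ℝ) : ℂ) := by
  let c := ∏ z ∈ crossingPairs U V W,
      (Fintype.card (Vec p n) : ℝ) ^ 2 / ((B.beta (e.pair z)).card : ℝ)
  let R : (U ⊕ V ⊕ W → Vec p n) → Prop := fun x =>
    (∀ z ∈ crossingPairs U V W, (x z.1, x z.2) ∈ B.beta (e.pair z)) ∧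
      ∀ u v w, Q u v w (x (Sum.inl u) + x (Sum.inr (Sum.inl v)) + x (Sum.inr (Sum.inr w)))
  have hcard : {t ∈ tupleSet B e | ∀ u v w, Q u v w (t.1 u + t.2.1 v + t.2.2 w)}.ncard
      = ((Fintype.piFinset fun i => B.atom (e.vertex i)).filter R).card := by
    let φ : (U ⊕ V ⊕ W → Vec p n) → (U → Vec p n) × (V → Vec p n) × (W → Vec p n) := fun x =>
      (fun u => x (Sum.inl u), fun v => x (Sum.inr (Sum.inl v)), fun w => x (Sum.inr (Sum.inr w)))
    have hφ : Function.Injective φ := by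
      intro x y hxy
      simp only [φ, Prod.mk.injEq, funext_iff] at hxy
      ext (u | v | w) : 1
      · exact funext (hxy.1 u)
      · exact funext (hxy.2.1 v)
      · exact funext (hxy.2.2 w)
    rw [← Set.ncard_coe_finset, ← Set.ncard_image_of_injective _ hφ]
    congr 1
    ext ⟨x, y, z⟩
    have hbeta : (∀ s ∈ crossingPairs U V W, ((Sum.elim x (Sum.elim y z) : U ⊕ V ⊕ W → Vec p n) s.1,
          (Sum.elim x (Sum.elim y z) : U ⊕ V ⊕ W → Vec p n) s.2) ∈ B.beta (e.pair s)) ↔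
        ∀ u v w, (x u, y v) ∈ B.beta (e.dUV u v) ∧ (x u, z w) ∈ B.beta (e.dUW u w) ∧
          (y v, z w) ∈ B.beta (e.dVW v w) := by
      constructor
      · intro h u v w
        exact ⟨h (Sum.inl u, Sum.inr (Sum.inl v)) (mem_crossingPairs.2 rfl),
          h (Sum.inl u, Sum.inr (Sum.inr w)) (mem_crossingPairs.2 rfl),
          h (Sum.inr (Sum.inl v), Sum.inr (Sum.inr w)) (mem_crossingPairs.2 rfl)⟩
      · intro h s hs
        rw [mem_crossingPairs] at hs
        -- `tupleSet` quantifies over `u`, `v`, `w` jointly, so extracting a condition on one pair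
        -- requires an element of the third class.
        inhabit U
        inhabit V
        inhabit W
        rcases s with ⟨u | v | w, u' | v' | w'⟩
        · simp [crossing] at hs
        · exact (h u v' default).1
        · exact (h u default w').2.1
        · simp [crossing] at hs
        · simp [crossing] at hs
        · exact (h default v w').2.2
        · simp [crossing] at hs
        · simp [crossing] at hs
        · simp [crossing] at hs
    have hatom : (∀ i, (Sum.elim x (Sum.elim y z) : U ⊕ V ⊕ W → Vec p n) i ∈ B.atom (e.vertex i)) ↔
        (∀ u, x u ∈ B.atom (e.a u)) ∧ (∀ v, y v ∈ B.atom (e.b v)) ∧ ∀ w, z w ∈ B.atom (e.c w) := by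
      simp only [Sum.forall, Sum.elim_inl, Sum.elim_inr, LabelFamily.vertex]
    have himage : (x, y, z) ∈ φ '' (((Fintype.piFinset fun i => B.atom (e.vertex i)).filter R :
          Finset (U ⊕ V ⊕ W → Vec p n)) : Set (U ⊕ V ⊕ W → Vec p n)) ↔
        Sum.elim x (Sum.elim y z) ∈ (Fintype.piFinset fun i => B.atom (e.vertex i)).filter R :=
      hφ.mem_set_image (a := Sum.elim x (Sum.elim y z))
    rw [himage, mem_filter, Fintype.mem_piFinset, hatom]
    simp only [R]
    rw [hbeta]
    simp only [tupleSet, Set.mem_ofPred_eq, Sum.elim_inl, Sum.elim_inr, and_assoc]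
  rw [hcard, ternaryOp_eq]
  have hterm : ∀ x : U ⊕ V ⊕ W → Vec p n,
      ((∏ z ∈ crossingPairs U V W, B.mu (e.pair z) (x z.1) (x z.2) : ℝ) : ℂ) *
        (∏ u, ∏ v, ∏ w, if Q u v w (x (Sum.inl u) + x (Sum.inr (Sum.inl v)) + x (Sum.inr (Sum.inr w)))
          then (1 : ℂ) else 0) = if R x then (c : ℂ) else 0 := by
    intro x
    rw [QuadraticFactor.prod_mu_eq]
    have hQ : (∏ u, ∏ v, ∏ w,
        if Q u v w (x (Sum.inl u) + x (Sum.inr (Sum.inl v)) + x (Sum.inr (Sum.inr w)))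
          then (1 : ℂ) else 0) = if ∀ u v w,
          Q u v w (x (Sum.inl u) + x (Sum.inr (Sum.inl v)) + x (Sum.inr (Sum.inr w)))
          then 1 else 0 := by
      simp only [Fintype.prod_boole]
    rw [hQ]
    by_cases h1 : ∀ z ∈ crossingPairs U V W, (x z.1, x z.2) ∈ B.beta (e.pair z)
    · by_cases h2 : ∀ u v w,
          Q u v w (x (Sum.inl u) + x (Sum.inr (Sum.inl v)) + x (Sum.inr (Sum.inr w)))
      · rw [if_pos h1, if_pos h2, if_pos (show R x from ⟨h1, h2⟩), mul_one]
      · rw [if_neg h2, if_neg (show ¬ R x from fun h => h2 h.2), mul_zero]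
    · rw [if_neg h1, if_neg (show ¬ R x from fun h => h1 h.1), Complex.ofReal_zero, zero_mul]
  have hsum : (∑ x ∈ Fintype.piFinset fun i => B.atom (e.vertex i), if R x then (c : ℂ) else 0)
      = (((Fintype.piFinset fun i => B.atom (e.vertex i)).filter R).card : ℂ) * c := by
    rw [← nsmul_eq_mul, ← sum_const, sum_filter]
    exact sum_congr rfl fun x _ => by congr
  rw [expect_congr rfl fun x _ => hterm x, expect_eq_sum_div_card, hsum, weightScale]
  simp only [c]
  push_cast
  ring

end Counting
-- Choice of parameters and the two estimates.
section Main

set_option linter.unusedSectionVars false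

theorem QuadraticFactor.isQuasirandom {p n l q : ℕ} [Fact p.Prime] (B : QuadraticFactor p n l q)
    (hp : 2 < p) {K s : ℕ} (hK : 1 ≤ K)
    (hB : ∀ c : Fin q → ZMod p, c ≠ 0 → 2 * (K * (l + q) + s) ≤ (∑ j, c j • B.M j).rank)
    {δ : ℝ} (hδ : δ ≤ 1) (hs : 2 * ((K : ℝ) + 2) / 3 ^ s ≤ δ) : B.IsQuasirandom K δ :=
  fun _ _ _ a S d hS hJ => B.abs_expect_prod_mu_le hp K s hB a S hS hK hJ d hδ hs

theorem QuadraticFactor.le_rank_of_le {p n l q : ℕ} [Fact p.Prime] (B : QuadraticFactor p n l q)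
    {τ : ℝ} {N : ℕ} (hN : (N : ℝ) ≤ τ) (hτ : (τ : EReal) ≤ B.rank) (c : Fin q → ZMod p)
    (hc : c ≠ 0) : N ≤ (∑ j, c j • B.M j).rank := by
  have h : (τ : EReal) ≤ (((∑ j, c j • B.M j).rank : ℝ) : EReal) :=
    hτ.trans (iInf₂_le c hc)
  exact_mod_cast hN.trans (EReal.coe_le_coe_iff.1 h)

theorem one_add_pow_mul_le {δ ε a : ℝ} (hδ₀ : 0 ≤ δ) (hδ : δ ≤ 1 / 20) (hε : 0 < ε)
    (hδε : δ ≤ ε ^ 16 / 8) (ha₀ : 0 ≤ a) (ha : a ≤ ε) :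
    (1 + δ) ^ 7 * (a ^ 8 + √((1 + δ) * (4 * δ))) ≤ (2 * ε) ^ 8 := by
  have h1 : (1 + δ) ^ 7 ≤ 2 := by
    calc (1 + δ) ^ 7 ≤ (1 + 1 / 20) ^ 7 := by gcongr
      _ ≤ 2 := by norm_num
  -- Here `(1 + δ) * (4 * δ) ≤ 8 * δ ≤ ε ^ 16`, whence the condition on `δ`.
  have h2 : √((1 + δ) * (4 * δ)) ≤ ε ^ 8 := by
    rw [Real.sqrt_le_left (by positivity)]
    nlinarith
  have h3 : a ^ 8 ≤ ε ^ 8 := by gcongr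
  have h4 : 0 ≤ ε ^ 8 := by positivity
  calc _ ≤ 2 * (ε ^ 8 + ε ^ 8) := by gcongr
    _ ≤ _ := by rw [mul_pow]; linarith

variable {p n l q : ℕ} [Fact p.Prime] {U V W : Type} [Fintype U] [Fintype V] [Fintype W]
  [DecidableEq U] [DecidableEq V] [DecidableEq W]

open Classical in
theorem norm_ternaryOpPair_sub_le {B : QuadraticFactor p n l q} {K : ℕ} {δ ε : ℝ}
    (hB : B.IsQuasirandom K δ) (hδ₀ : 0 ≤ δ) (hδ : δ ≤ 1 / 20) (hε : 0 < ε)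
    (hδε : δ ≤ ε ^ 16 / 8)
    (hK : 2 * Fintype.card (U ⊕ V ⊕ W) + (2 * Fintype.card (U ⊕ V ⊕ W)) ^ 2 ≤ K)
    (F : TripartiteHypergraph U V W) (A : Finset (Vec p n)) (e : LabelFamily p l q U V W)
    {α : U → V → W → ℝ} (hα₀ : ∀ u v w, 0 ≤ α u v w) (hα₁ : ∀ u v w, α u v w ≤ 1)
    (hU : ∀ u v w, B.localU3Norm (e.tuple u v w) (fun x => ind A x - (α u v w : ℂ)) ≤ ε) :
    ‖ternaryOpPair F B e (ind A) (ind Aᶜ) -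
        (edgeProduct F α : ℂ) * ternaryOp B e fun _ _ _ _ => 1‖
      ≤ Fintype.card (U × V × W) * (2 * ε) := by
  have hind : ∀ (A : Finset (Vec p n)) y, ind A y = ((if y ∈ A then 1 else 0 : ℝ) : ℂ) := by
    intro A y
    unfold ind
    split_ifs <;> simp
  have hcompl : ∀ y, ind Aᶜ y = 1 - ind A y := by
    intro y
    by_cases hy : y ∈ A <;> simp [ind, hy]
  have hind₁ : ∀ (A : Finset (Vec p n)) y, ‖ind A y‖ ≤ 1 := by
    intro A y
    unfold ind
    split_ifs <;> simp
  have hr : ∀ u v w y, ‖ind A y - (α u v w : ℂ)‖ ≤ 1 := by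
    intro u v w y
    have h1 := hα₀ u v w
    have h2 := hα₁ u v w
    rw [hind, ← Complex.ofReal_sub, Complex.norm_real, Real.norm_eq_abs, abs_le]
    split_ifs <;> constructor <;> linarith
  have hconst : (edgeProduct F α : ℂ) * ternaryOp B e (fun _ _ _ _ => 1) =
      ternaryOp B e fun u v w _ => ((if F.IsEdge u v w then α u v w else 1 - α u v w : ℝ) : ℂ) := by
    rw [ternaryOp_const B e fun u v w =>
      ((if F.IsEdge u v w then α u v w else 1 - α u v w : ℝ) : ℂ), edgeProduct_eq]
    simp only [Complex.ofReal_prod]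
  rw [hconst, ternaryOpPair]
  refine norm_ternaryOp_sub_le
    (f := fun t => if F.IsEdge t.1 t.2.1 t.2.2 then ind A else ind Aᶜ)
    (g := fun t _ => ((if F.IsEdge t.1 t.2.1 t.2.2 then α t.1 t.2.1 t.2.2
      else 1 - α t.1 t.2.1 t.2.2 : ℝ) : ℂ))
    (r := fun t y => ind A y - (α t.1 t.2.1 t.2.2 : ℂ)) ?_ ?_ ?_ ?_ ?_
  · intro t y
    split_ifs
    · exact hind₁ _ _
    · exact hind₁ _ _
  · intro t y
    have h1 := hα₀ t.1 t.2.1 t.2.2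
    have h2 := hα₁ t.1 t.2.1 t.2.2
    rw [Complex.norm_real, Real.norm_eq_abs, abs_le]
    split_ifs <;> constructor <;> linarith
  · exact fun t y => hr _ _ _ y
  · intro t
    by_cases ht : F.IsEdge t.1 t.2.1 t.2.2
    · left
      intro y
      simp only [ht, if_true]
      ring
    · right
      intro y
      simp only [ht, if_false, hcompl]
      push_cast
      ring
  · intro h t₀ hh ht₀
    have key := norm_ternaryOp_pow_eight_le hB hδ₀ (by linarith) hK e
      (fun u v w => h (u, v, w)) (fun u v w y => hh _ y) t₀.1 t₀.2.1 t₀.2.2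
    have ht : h (t₀.1, t₀.2.1, t₀.2.2) = fun x => ind A x - (α t₀.1 t₀.2.1 t₀.2.2 : ℂ) := ht₀
    rw [ht] at key
    exact le_of_pow_le_pow_left₀ (by norm_num) (by positivity) (key.trans
      (one_add_pow_mul_le hδ₀ hδ hε hδε (localU3Norm_nonneg _ _ _) (hU _ _ _)))

open Classical in
theorem edgeProduct_mem_Icc (F : TripartiteHypergraph U V W) {α : U → V → W → ℝ}
    (hα₀ : ∀ u v w, 0 ≤ α u v w) (hα₁ : ∀ u v w, α u v w ≤ 1) :
    0 ≤ edgeProduct F α ∧ edgeProduct F α ≤ 1 := by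
  have h0 : ∀ u v w, 0 ≤ if F.IsEdge u v w then α u v w else 1 - α u v w := by
    intro u v w
    split_ifs
    · exact hα₀ u v w
    · linarith [hα₁ u v w]
  have h1 : ∀ u v w, (if F.IsEdge u v w then α u v w else 1 - α u v w) ≤ 1 := by
    intro u v w
    split_ifs
    · exact hα₁ u v w
    · linarith [hα₀ u v w]
  rw [edgeProduct_eq]
  have p0 := fun u v => prod_nonneg fun w (_ : w ∈ univ) => h0 u v w
  have p1 := fun u v => prod_le_one (fun w (_ : w ∈ univ) => h0 u v w) fun w _ => h1 u v w
  have q0 := fun u => prod_nonneg fun v (_ : v ∈ univ) => p0 u v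
  have q1 := fun u => prod_le_one (fun v (_ : v ∈ univ) => p0 u v) fun v _ => p1 u v
  exact ⟨prod_nonneg fun u _ => q0 u, prod_le_one (fun u _ => q0 u) fun u _ => q1 u⟩

theorem QuadraticFactor.density_mem_Icc (B : QuadraticFactor p n l q) (A : Finset (Vec p n))
    (a : AtomLabel p l q) : 0 ≤ B.density A a ∧ B.density A a ≤ 1 := by
  refine ⟨div_nonneg (by positivity) (by positivity), div_le_one_of_le₀ ?_ (by positivity)⟩
  exact_mod_cast card_le_card inter_subset_right

theorem inducedCopies_of_isEmpty (F : TripartiteHypergraph U V W) (B : QuadraticFactor p n l q)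
    (e : LabelFamily p l q U V W) (A : Finset (Vec p n)) (h : IsEmpty (U × V × W)) :
    inducedCopies F B e A = tupleSet B e := by
  ext t
  exact ⟨fun ht => ht.1, fun ht => ⟨ht, fun u v w => (h.false (u, v, w)).elim⟩⟩

open Classical in
theorem edgeProduct_of_isEmpty (F : TripartiteHypergraph U V W) (α : U → V → W → ℝ)
    (h : IsEmpty (U × V × W)) : edgeProduct F α = 1 := by
  simp [edgeProduct]

open Classical in
theorem ternaryOpPair_eq [Nonempty U] [Nonempty V] [Nonempty W] (F : TripartiteHypergraph U V W)
    (B : QuadraticFactor p n l q) (e : LabelFamily p l q U V W) (A : Finset (Vec p n)) :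
    ternaryOpPair F B e (ind A) (ind Aᶜ)
      = ((weightScale B e * ((inducedCopies F B e A).ncard : ℝ) : ℝ) : ℂ) := by
  rw [show inducedCopies F B e A = {t ∈ tupleSet B e | ∀ u v w,
    (t.1 u + t.2.1 v + t.2.2 w ∈ A ↔ F.IsEdge u v w)} from rfl,
    ← ternaryOp_indicator B e fun u v w y => (y ∈ A ↔ F.IsEdge u v w), ternaryOpPair]
  congr 1
  ext u v w y
  by_cases h : F.IsEdge u v w <;> by_cases hy : y ∈ A <;> simp [h, hy, ind]

theorem ternaryOp_one_eq [Nonempty U] [Nonempty V] [Nonempty W] (B : QuadraticFactor p n l q)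
    (e : LabelFamily p l q U V W) :
    ternaryOp B e (fun _ _ _ _ => 1)
      = ((weightScale B e * ((tupleSet B e).ncard : ℝ) : ℝ) : ℂ) := by
  have h := ternaryOp_indicator B e fun _ _ _ _ => True
  simpa using h

/-- Both operators equal the scale `κ` times a cardinality, so `κ` can be divided out. Since `κ * N`
is nearly 1, in particular at least `1 / 2`, an absolute error `2 * ε` per triple becomes a relative
error `4 * ε`. -/
theorem abs_ncard_inducedCopies_sub_le {B : QuadraticFactor p n l q} {K : ℕ} {δ ε : ℝ}
    (hB : B.IsQuasirandom K δ) (hδ₀ : 0 ≤ δ) (hδ : δ ≤ 1 / 20) (hε : 0 < ε)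
    (hδε : δ ≤ ε ^ 16 / 8)
    (hK : 2 * Fintype.card (U ⊕ V ⊕ W) + (2 * Fintype.card (U ⊕ V ⊕ W)) ^ 2 ≤ K)
    (F : TripartiteHypergraph U V W) (A : Finset (Vec p n)) (e : LabelFamily p l q U V W)
    {α : U → V → W → ℝ} (hα₀ : ∀ u v w, 0 ≤ α u v w) (hα₁ : ∀ u v w, α u v w ≤ 1)
    (hU : ∀ u v w, B.localU3Norm (e.tuple u v w) (fun x => ind A x - (α u v w : ℂ)) ≤ ε) :
    |((inducedCopies F B e A).ncard : ℝ) - edgeProduct F α * ((tupleSet B e).ncard : ℝ)|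
      ≤ 4 * Fintype.card (U × V × W) * ε * ((tupleSet B e).ncard : ℝ) := by
  -- With an empty class there are no triples: every tuple counts and the edge product is 1.
  rcases isEmpty_or_nonempty (U × V × W) with hempty | ⟨⟨u₀, v₀, w₀⟩⟩
  · rw [inducedCopies_of_isEmpty F B e A hempty, edgeProduct_of_isEmpty F α hempty]
    simp
  have : Nonempty U := ⟨u₀⟩
  have : Nonempty V := ⟨v₀⟩
  have : Nonempty W := ⟨w₀⟩
  have h1 := norm_ternaryOpPair_sub_le hB hδ₀ hδ hε hδε hK F A e hα₀ hα₁ hU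
  have h2 := hB.abs_expect_crossing_le hK e
  rw [ternaryOp_one_eq] at h1 h2
  rw [ternaryOpPair_eq, ← Complex.ofReal_mul, ← Complex.ofReal_sub, Complex.norm_real,
    Real.norm_eq_abs] at h1
  rw [← Complex.ofReal_one, ← Complex.ofReal_sub, Complex.norm_real, Real.norm_eq_abs] at h2
  set κ := weightScale B e
  set N : ℝ := ((tupleSet B e).ncard : ℝ)
  set N' : ℝ := ((inducedCopies F B e A).ncard : ℝ)
  have hhalf : 1 / 2 ≤ κ * N := by linarith [(abs_le.1 h2).1]
  have hκ : 0 < κ := by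
    refine lt_of_le_of_ne (weightScale_nonneg B e) fun h => ?_
    rw [← h, zero_mul] at hhalf
    linarith
  have e1 : κ * N' - edgeProduct F α * (κ * N) = κ * (N' - edgeProduct F α * N) := by ring
  rw [e1, abs_mul, abs_of_pos hκ] at h1
  refine le_of_mul_le_mul_left (h1.trans ?_) hκ
  have hnonneg : 0 ≤ (Fintype.card (U × V × W) : ℝ) * (2 * ε) := by positivity
  calc (Fintype.card (U × V × W) : ℝ) * (2 * ε)
      = (Fintype.card (U × V × W) : ℝ) * (2 * ε) * (2 * (1 / 2)) := by ring
    _ ≤ (Fintype.card (U × V × W) : ℝ) * (2 * ε) * (2 * (κ * N)) := by gcongr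
    _ = _ := by ring

end Main
end TernaryCount

theorem mainTheorem7 (m : ℕ) (hm : 0 < m) :
    ∃ C : ℝ, 0 < C ∧ ∀ ε : ℝ, 0 < ε →
      ∃ τ₀ : ℝ → ℝ, TernaryCount.IsGrowthFunction τ₀ ∧
        ∀ τ : ℝ → ℝ, TernaryCount.IsGrowthFunction τ → (∀ x, 0 < x → τ₀ x ≤ τ x) →
        ∀ (p : ℕ) [Fact p.Prime], 2 < p →
        ∀ (n l q : ℕ) (U V W : Finset (Fin m)) (F : TernaryCount.TripartiteHypergraph U V W)
          (B : TernaryCount.QuadraticFactor p n l q),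
          ((τ ((l + q : ℕ) : ℝ) : ℝ) : EReal) ≤ B.rank →
        ∀ (A : Finset (TernaryCount.Vec p n)) (e : TernaryCount.LabelFamily p l q U V W)
          (α : U → V → W → ℝ),
          (∀ u v w, α u v w = B.density A (e.tuple u v w).sigma) →
          (∀ u v w, B.localU3Norm (e.tuple u v w)
            (fun x => TernaryCount.ind A x - (α u v w : ℂ)) ≤ ε) →
          ‖TernaryCount.ternaryOpPair F B e (TernaryCount.ind A) (TernaryCount.ind Aᶜ)
              - (TernaryCount.edgeProduct F α : ℂ)‖ < 3 * ε * (m : ℝ) ^ 3 ∧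
          |((TernaryCount.inducedCopies F B e A).ncard : ℝ)
              - TernaryCount.edgeProduct F α * ((TernaryCount.tupleSet B e).ncard : ℝ)|
            ≤ C * ε * ((TernaryCount.tupleSet B e).ncard : ℝ) := by
  have hm1 : (1 : ℝ) ≤ m := by exact_mod_cast hm
  have hm3 : (1 : ℝ) ≤ (m : ℝ) ^ 3 := one_le_pow₀ hm1
  refine ⟨4 * (m : ℝ) ^ 3, by positivity, fun ε hε => ?_⟩
  -- At most `3 * m` vertices, doubled, together with all pairs of them.
  set K : ℕ := 2 * (3 * m) + (2 * (3 * m)) ^ 2 with hKdef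
  have hK1 : 1 ≤ K := by omega
  -- The first two bounds give `2 * ε` per triple through `one_add_pow_mul_le`; the third controls
  -- the deviation of the average of the weights from 1.
  set δ : ℝ := min (1 / 20) (min (ε ^ 16 / 8) (ε / 2)) with hδdef
  have hδ0 : 0 < δ := by positivity
  have hδ1 : δ ≤ 1 / 20 := min_le_left _ _
  have hδ2 : δ ≤ ε ^ 16 / 8 := (min_le_right _ _).trans (min_le_left _ _)
  have hδ3 : δ ≤ ε / 2 := (min_le_right _ _).trans (min_le_right _ _)
  obtain ⟨s, hs⟩ := pow_unbounded_of_one_lt (2 * ((K : ℝ) + 2) / δ) (by norm_num : (1 : ℝ) < 3)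
  have hs' : 2 * ((K : ℝ) + 2) / 3 ^ s ≤ δ := by
    rw [div_lt_iff₀ hδ0] at hs
    rw [div_le_iff₀ (by positivity)]
    linarith
  refine ⟨fun x => 2 * (K * x + s), ⟨fun x _ y _ hxy => ?_, fun x hx => ?_⟩, ?_⟩
  · dsimp only
    gcongr
  · have : (0 : ℝ) < K := by exact_mod_cast hK1
    positivity
  intro τ _ hτ p _ hp n l q U V W F B hrank A e α hα hU
  have hB : B.IsQuasirandom K δ := by
    refine B.isQuasirandom hp hK1 (fun c hc => ?_) (by linarith) hs'
    -- A nonzero `c` forces `q > 0`, so `l + q` is positive, where `τ₀ ≤ τ` is available.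
    have hq : 0 < q := by
      rcases Nat.eq_zero_or_pos q with rfl | h
      · exact absurd (Subsingleton.elim c 0) hc
      · exact h
    refine B.le_rank_of_le (le_trans ?_ (hτ _ ?_)) hrank c hc
    · push_cast
      exact le_rfl
    · exact_mod_cast Nat.add_pos_right l hq
  have hcardU : ∀ S : Finset (Fin m), Fintype.card S ≤ m := fun S => by
    rw [Fintype.card_coe]
    exact (Finset.card_le_univ S).trans (Fintype.card_fin m).le
  have hK : 2 * Fintype.card (U ⊕ V ⊕ W) + (2 * Fintype.card (U ⊕ V ⊕ W)) ^ 2 ≤ K := by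
    have h : Fintype.card (U ⊕ V ⊕ W) ≤ 3 * m := by
      rw [Fintype.card_sum, Fintype.card_sum]
      linarith [hcardU U, hcardU V, hcardU W]
    rw [hKdef]
    gcongr
  have hcard : (Fintype.card (U × V × W) : ℝ) ≤ (m : ℝ) ^ 3 := by
    have h : Fintype.card (U × V × W) ≤ m ^ 3 := by
      rw [Fintype.card_prod, Fintype.card_prod]
      calc _ ≤ m * (m * m) := Nat.mul_le_mul (hcardU U) (Nat.mul_le_mul (hcardU V) (hcardU W))
        _ = m ^ 3 := by ring
    exact_mod_cast h
  have hα₀ : ∀ u v w, 0 ≤ α u v w := fun u v w => by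
    rw [hα]; exact (B.density_mem_Icc A _).1
  have hα₁ : ∀ u v w, α u v w ≤ 1 := fun u v w => by
    rw [hα]; exact (B.density_mem_Icc A _).2
  constructor
  · have h1 := TernaryCount.norm_ternaryOpPair_sub_le hB hδ0.le hδ1 hε hδ2 hK F A e hα₀ hα₁ hU
    have h2 := hB.abs_expect_crossing_le hK e
    have hP := TernaryCount.edgeProduct_mem_Icc F hα₀ hα₁
    have h3 : ‖(TernaryCount.edgeProduct F α : ℂ) * TernaryCount.ternaryOp B e (fun _ _ _ _ => 1)
        - (TernaryCount.edgeProduct F α : ℂ)‖ ≤ δ := by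
      rw [← mul_sub_one, norm_mul, Complex.norm_real, Real.norm_of_nonneg hP.1]
      exact (mul_le_of_le_one_left (norm_nonneg _) hP.2).trans h2
    calc _ ≤ _ := norm_sub_le_norm_sub_add_norm_sub _
          ((TernaryCount.edgeProduct F α : ℂ) * TernaryCount.ternaryOp B e fun _ _ _ _ => 1) _
      _ ≤ Fintype.card (U × V × W) * (2 * ε) + δ := add_le_add h1 h3
      _ ≤ (m : ℝ) ^ 3 * (2 * ε) + ε / 2 := by gcongr
      -- The spare `ε * m ^ 3` exceeds `ε / 2` because `m ≥ 1`.
      _ < 3 * ε * (m : ℝ) ^ 3 := by nlinarith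
  · refine (TernaryCount.abs_ncard_inducedCopies_sub_le hB hδ0.le hδ1 hε hδ2 hK F A e hα₀ hα₁
      hU).trans ?_
    gcongr
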